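/- **Setting.** Let $K$ be a fixed number of factors, let $\mathbf f=(f_1,\dots,f_K)'$ be a random vector that does not depend on $n$, and for each sample size $n$ let $p=p_n$ be a dimension with $K\le p_n$, $\mathbf B_n$ a deterministic $p_n\times K$ matrix, $\boldsymbol\varepsilon=\boldsymbol\varepsilon_n$ a random vector in $\mathbb R^{p_n}$, and $\mathbf y=\mathbf y_n=\mathbf B_n\mathbf f+\boldsymbol\varepsilon_n$. Assume: (A) $(\mathbf f_1,\mathbf y_1),\dots,(\mathbf f_n,\mathbf y_n)$ are $n$ i.i.d. samples of $(\mathbf f,\mathbf y_n)$ (for different $n$ the samples may live on different probability spaces); $E(\boldsymbol\varepsilon_n\mid\mathbf f)=\mathbf 0$ and $\operatorname{cov}(\boldsymbol\varepsilon_n\mid\mathbf f)=\Sigma_{n,0}$ is a deterministic diagonal matrix; the distribution of $\mathbf f$ is continuous (has no atoms). (B) $E\|\mathbf y_n\|^2=O(p_n)$; $E f_k^4<\infty$ for $1\le k\le K$; $\sup_n\max_{1\le i\le p_n}E\varepsilon_{n,i}^4<\infty$; and there is $\sigma_1>0$ with $\lambda_{\min}(\operatorname{cov}(\mathbf f))\ge\sigma_1$.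 (D) $p_n^{-1}\mathbf B_n'\mathbf B_n\to\mathbf A$ as $n\to\infty$ for some symmetric positive semidefinite $K\times K$ matrix $\mathbf A$. Let $\Sigma_n=\operatorname{cov}(\mathbf y_n)$, $\mathbf X=(\mathbf f_1,\dots,\mathbf f_n)$, $\mathbf Y=(\mathbf y_1,\dots,\mathbf y_n)$, and let $$\widehat\Sigma_n=\widehat{\mathbf B}_n\,\widehat{\operatorname{cov}}(\mathbf f)\,\widehat{\mathbf B}_n'+\operatorname{diag}\bigl(n^{-1}\widehat{\mathbf E}\widehat{\mathbf E}'\bigr),$$ where $\widehat{\mathbf B}_n=\mathbf Y\mathbf X'(\mathbf X\mathbf X')^{-1}$, $\widehat{\operatorname{cov}}(\mathbf f)=(n-1)^{-1}\mathbf X\mathbf X'-\{n(n-1)\}^{-1}\mathbf X\mathbf 1\mathbf 1'\mathbf X'$, $\widehat{\mathbf E}=\mathbf Y-\widehat{\mathbf B}_n\mathbf X$, and $\operatorname{diag}(M)$ keeps the diagonal of $M$ and replaces the other entries by $0$. (Where $\mathbf X\mathbf X'$ is singular, $(\mathbf X\mathbf X')^{-1}$ is read as $0$; the probability of this event tends to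 $0$.) For a $K\times K$ matrix $M$, $\operatorname{vec}(M)$ stacks the columns of $M$ and $\operatorname{vech}(M)$ is obtained from $\operatorname{vec}(M)$ by removing the entries above the diagonal. $D$ is the duplication matrix of order $K$, the $0$-$1$ matrix with $D\operatorname{vech}(M)=\operatorname{vec}(M)$ for all symmetric $M$, and $P_D=(D'D)^{-1}D'$. **Theorem (Asymptotic normality).** If moreover $p_n\to\infty$ as $n\to\infty$, then $$\sqrt n\,\operatorname{vech}\bigl[p_n^{-2}\mathbf B_n'(\widehat\Sigma_n-\Sigma_n)\mathbf B_n\bigr]\xrightarrow{\ D\ }\mathcal N(0,G),\qquad G=P_D(\mathbf A\otimes\mathbf A)DHD'(\mathbf A\otimes\mathbf A)P_D',$$ where $G$ is positive semidefinite and $H=\operatorname{cov}[\operatorname{vech}(U)]$ with $U=(u_{ij})_{K\times K}=(\mathbf f-E\mathbf f)(\mathbf f-E\mathbf f)'$, so that $$\operatorname{cov}(u_{ij},u_{kl})=\kappa^{ijkl}+\kappa^{ik}\kappa^{jl}+\kappa^{il}\kappa^{jk}.$$ Here $\kappa^{ij}=m_{ij}$ and $\kappa^{ijkl}=m_{ijkl}-m_{ij}m_{kl}-m_{ik}m_{jl}-m_{il}m_{jk}$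 are the second and fourth order joint cumulants of $\mathbf f$, with $m_{i_1\cdots i_r}=E[(f_{i_1}-Ef_{i_1})\cdots(f_{i_r}-Ef_{i_r})]$ the joint central moments. -/

import Mathlib

open MeasureTheory ProbabilityTheory Filter Topology Matrix Asymptotics
open scoped Kronecker

namespace FactorModel

noncomputable section

/-! ### Half-vectorization and the duplication matrix -/

/-- Positions `(j, i)` (column `j`, row `i`) of a `d × d` matrix on or below the diagonal. -/
abbrev VechIndex (d : ℕ) : Type := {q : Fin d × Fin d // q.1 ≤ q.2}

/-- `vech A` is obtained from `vec A` (which stacks the columns of `A`) by removing the entries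
above the diagonal. -/
def vech {d : ℕ} (A : Matrix (Fin d) (Fin d) ℝ) : VechIndex d → ℝ :=
  fun r => A.vec r.1

/-- The duplication matrix `D_d`. -/
def dup (d : ℕ) : Matrix (Fin d × Fin d) (VechIndex d) ℝ :=
  Matrix.of fun q r => if r.1 = q ∨ r.1 = q.swap then 1 else 0

/-- `D vech(A) = vec(A)` for symmetric `A`. -/
theorem dup_mulVec_vech {d : ℕ} (A : Matrix (Fin d) (Fin d) ℝ) (hA : A.IsSymm) :
    dup d *ᵥ vech A = A.vec := by
  funext q
  obtain ⟨j, i⟩ := q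
  have hs : A i j = A j i := hA.apply j i
  rcases le_total j i with h | h
  · rw [Matrix.mulVec, dotProduct, Finset.sum_eq_single (⟨(j, i), h⟩ : VechIndex d)]
    · simp [dup, vech]
    · rintro ⟨⟨a, b⟩, hab⟩ _ hne
      have : ¬ ((a, b) = (j, i) ∨ (a, b) = (i, j)) := by
        rintro (h1 | h1)
        · exact hne (Subtype.ext h1)
        · obtain ⟨rfl, rfl⟩ := Prod.mk.inj h1
          have : a = b := le_antisymm hab h
          subst this
          exact hne rfl
      simp only [dup, Matrix.of_apply, Prod.swap_prod_mk, if_neg this, zero_mul]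
    · simp
  · rw [Matrix.mulVec, dotProduct, Finset.sum_eq_single (⟨(i, j), h⟩ : VechIndex d)]
    · simp [dup, vech, hs]
    · rintro ⟨⟨a, b⟩, hab⟩ _ hne
      have : ¬ ((a, b) = (j, i) ∨ (a, b) = (i, j)) := by
        rintro (h1 | h1)
        · obtain ⟨rfl, rfl⟩ := Prod.mk.inj h1
          have : a = b := le_antisymm hab h
          subst this
          exact hne rfl
        · exact hne (Subtype.ext h1)
      simp only [dup, Matrix.of_apply, Prod.swap_prod_mk, if_neg this, zero_mul]
    · simp

/-- `P_D = (D' D)⁻¹ D'`. -/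
def dupPinv (d : ℕ) : Matrix (VechIndex d) (Fin d × Fin d) ℝ :=
  ((dup d)ᵀ * dup d)⁻¹ * (dup d)ᵀ

/-! ### Moments of random vectors -/

section Moments

variable {Ω : Type*} [MeasurableSpace Ω]

/-- The covariance matrix of a random vector. -/
def covMat {ι : Type*} (X : Ω → ι → ℝ) (P : Measure Ω) : Matrix ι ι ℝ :=
  Matrix.of fun i j => cov[fun ω => X ω i, fun ω => X ω j; P]

theorem covMat_isHermitian {ι : Type*} (X : Ω → ι → ℝ) (P : Measure Ω) :
    (covMat X P).IsHermitian := by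
  ext i j
  simp [covMat, covariance_comm]

/-- The conditional covariance of two random variables given a random vector `Z`. -/
def condCov {K : ℕ} (U V : Ω → ℝ) (Z : Ω → Fin K → ℝ) (P : Measure Ω) : Ω → ℝ :=
  P[fun ω => (U ω - (P[U | MeasurableSpace.comap Z inferInstance]) ω) *
      (V ω - (P[V | MeasurableSpace.comap Z inferInstance]) ω) |
    MeasurableSpace.comap Z inferInstance]

/-- The joint central moment `E[(f_{s 0} - E f_{s 0}) ⋯ (f_{s (r-1)} - E f_{s (r-1)})]`. -/
def centralMom {K r : ℕ} (f : Ω → Fin K → ℝ) (P : Measure Ω) (s : Fin r → Fin K) : ℝ :=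
  ∫ ω, ∏ a, (f ω (s a) - ∫ ω', f ω' (s a) ∂P) ∂P

/-- The fourth order joint cumulant of `f_i, f_j, f_k, f_l`. -/
def cumulant4 {K : ℕ} (f : Ω → Fin K → ℝ) (P : Measure Ω) (i j k l : Fin K) : ℝ :=
  centralMom f P ![i, j, k, l]
    - centralMom f P ![i, j] * centralMom f P ![k, l]
    - centralMom f P ![i, k] * centralMom f P ![j, l]
    - centralMom f P ![i, l] * centralMom f P ![j, k]

/-- The centered outer product `U = (f - E f)(f - E f)'`. -/
def outerProd {K : ℕ} (f : Ω → Fin K → ℝ) (P : Measure Ω) (ω : Ω) :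
    Matrix (Fin K) (Fin K) ℝ :=
  Matrix.of fun i j => (f ω i - ∫ ω', f ω' i ∂P) * (f ω j - ∫ ω', f ω' j ∂P)

/-- `H = cov[vech(U)]`. -/
def Hmat {K : ℕ} (f : Ω → Fin K → ℝ) (P : Measure Ω) :
    Matrix (VechIndex K) (VechIndex K) ℝ :=
  covMat (fun ω => vech (outerProd f P ω)) P

/-- `G = P_D (A ⊗ A) D H D' (A ⊗ A) P_D'`. -/
def Gmat {K : ℕ} (A : Matrix (Fin K) (Fin K) ℝ) (H : Matrix (VechIndex K) (VechIndex K) ℝ) :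
    Matrix (VechIndex K) (VechIndex K) ℝ :=
  dupPinv K * (A ⊗ₖ A) * dup K * H * (dup K)ᵀ * (A ⊗ₖ A) * (dupPinv K)ᵀ

end Moments

/-! ### The substitution estimator -/

section Estimator

variable {n K p : ℕ}

/-- The least-squares estimator `Y X' (X X')⁻¹` of the loading matrix. -/
def Bhat (X : Matrix (Fin K) (Fin n) ℝ) (Y : Matrix (Fin p) (Fin n) ℝ) :
    Matrix (Fin p) (Fin K) ℝ :=
  Y * Xᵀ * (X * Xᵀ)⁻¹

/-- The sample covariance matrix `(n-1)⁻¹ X X' - {n(n-1)}⁻¹ X 1 1' X'` of the factors. -/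
def covHat (X : Matrix (Fin K) (Fin n) ℝ) : Matrix (Fin K) (Fin K) ℝ :=
  ((n : ℝ) - 1)⁻¹ • (X * Xᵀ)
    - ((n : ℝ) * ((n : ℝ) - 1))⁻¹ • (X * (Matrix.of fun _ _ => 1 : Matrix (Fin n) (Fin n) ℝ) * Xᵀ)

/-- The matrix of residuals `Y - B̂ X`. -/
def resid (X : Matrix (Fin K) (Fin n) ℝ) (Y : Matrix (Fin p) (Fin n) ℝ) :
    Matrix (Fin p) (Fin n) ℝ :=
  Y - Bhat X Y * X

/-- `Σ̂₀ = diag(n⁻¹ Ê Ê')`. -/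
def Sigma0Hat (X : Matrix (Fin K) (Fin n) ℝ) (Y : Matrix (Fin p) (Fin n) ℝ) :
    Matrix (Fin p) (Fin p) ℝ :=
  Matrix.diagonal (Matrix.diag ((n : ℝ)⁻¹ • (resid X Y * (resid X Y)ᵀ)))

/-- `Σ̂ = B̂ ĉov(f) B̂' + Σ̂₀`. -/
def SigmaHat (X : Matrix (Fin K) (Fin n) ℝ) (Y : Matrix (Fin p) (Fin n) ℝ) :
    Matrix (Fin p) (Fin p) ℝ :=
  Bhat X Y * covHat X * (Bhat X Y)ᵀ + Sigma0Hat X Y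

end Estimator

/-- The observable `y = B f + ε` of the factor model. -/
def obs {Ω : Type*} {K p : ℕ} (B : Matrix (Fin p) (Fin K) ℝ) (f : Ω → Fin K → ℝ)
    (ε : Ω → Fin p → ℝ) (ω : Ω) : Fin p → ℝ :=
  B *ᵥ f ω + ε ω

/-- The matrix whose `n` columns are the given vectors. -/
def dataMat {n d : ℕ} (x : Fin n → Fin d → ℝ) : Matrix (Fin d) (Fin n) ℝ :=
  Matrix.of fun a i => x i a

end

end FactorModel

open FactorModel

/-! Write E = Y − BX for the errors, C = cov(f), Ĉ for the sample covariance of the factors and T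
for the error covariance. Where XX' is invertible, B̂ − B = EX'(XX')⁻¹, while Σ = BCB' + T. Put L =
p⁻¹B'B, S = n⁻¹XX', W = p⁻¹n^(-1/2)B'EX' and V = √n(Ĉ − C). Multiplying out, √n p⁻²B'(Σ̂ − Σ)B
equals LVL, plus terms containing WS⁻¹, plus the remainder √n p⁻²B'(Σ̂₀ − T)B
(`smul_congr_SigmaHat_sub`).

Only LVL survives. Given the factors, the errors are uncorrelated with bounded variances, so
projecting them on a column of p⁻¹B leaves a variance O(1/p), and W → 0
(`matTendstoZeroInProb_loading_cross`). The remainder weights p coordinates, each bounded in mean,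
by p⁻²B_ak B_al, whose absolute values sum to O(1/p) (`tendstoZeroInProb_loading_average`). As p
diverges the error noise disappears and only the fluctuation of Ĉ is left.

Finally L → A and V = N + o_P(1), where N = n^(-1/2) ∑ (Uᵢ − C) is a normalized sum of centered
outer products, so the limit is that of vech(ANA). In vech coordinates M ↦ AMA is the matrix P_D(A ⊗
A)D, and the central limit theorem in fixed dimension (`tendstoInDistribution_normSum`) gives
covariance G. Slutsky's lemma (`tendstoInDistribution_of_norm_sub`) transfers the limit to the
estimator. -/

namespace FactorModel

/-! ### Calculus of o_P(1) and O_P(1) on varying probability spaces, and Slutsky's lemma -/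

section StochasticOrder

variable {Ω : ℕ → Type*} [∀ n, MeasurableSpace (Ω n)] {P : ∀ n, Measure (Ω n)}

/-- Convergence to zero in probability along a sequence of probability spaces. -/
def TendstoZeroInProb (P : ∀ n, Measure (Ω n)) (X : ∀ n, Ω n → ℝ) : Prop :=
  ∀ δ : ℝ, 0 < δ → Tendsto (fun n => (P n).real {ω | δ ≤ |X n ω|}) atTop (𝓝 0)

/-- Boundedness in probability along a sequence of probability spaces. -/
def BoundedInProb (P : ∀ n, Measure (Ω n)) (X : ∀ n, Ω n → ℝ) : Prop :=
  ∀ η : ℝ, 0 < η → ∃ M : ℝ, 0 < M ∧ ∀ᶠ n in atTop, (P n).real {ω | M ≤ |X n ω|} ≤ η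

variable {X Y : ∀ n, Ω n → ℝ}

theorem tendstoZeroInProb_iff :
    TendstoZeroInProb P X ↔ ∀ δ : ℝ, 0 < δ → ∀ η : ℝ, 0 < η →
      ∀ᶠ n in atTop, (P n).real {ω | δ ≤ |X n ω|} ≤ η := by
  refine forall₂_congr fun δ _ => ⟨fun h η hη => ?_, fun h => ?_⟩
  · exact (h.eventually (gt_mem_nhds hη)).mono fun n hn => hn.le
  · rw [tendsto_order]
    refine ⟨fun a ha => .of_forall fun n => ha.trans_le measureReal_nonneg, fun a ha => ?_⟩
    exact (h (a / 2) (by linarith)).mono fun n hn => by linarith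

theorem TendstoZeroInProb.boundedInProb (hX : TendstoZeroInProb P X) : BoundedInProb P X :=
  fun η hη => ⟨1, one_pos, tendstoZeroInProb_iff.1 hX 1 one_pos η hη⟩

variable [∀ n, IsProbabilityMeasure (P n)]

theorem TendstoZeroInProb.mono (hY : TendstoZeroInProb P Y)
    (h : ∀ᶠ n in atTop, ∀ ω, |X n ω| ≤ |Y n ω|) : TendstoZeroInProb P X := by
  rw [tendstoZeroInProb_iff] at hY ⊢
  intro δ hδ η hη
  filter_upwards [hY δ hδ η hη, h] with n hn h
  exact (measureReal_mono fun ω (hω : δ ≤ |X n ω|) => hω.trans (h ω)).trans hn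

/-- Convergence to zero in probability only depends on the variables up to events of vanishing
probability. -/
theorem TendstoZeroInProb.congr (hX : TendstoZeroInProb P X) {s : ∀ n, Set (Ω n)}
    (hs : Tendsto (fun n => (P n).real (s n)) atTop (𝓝 0))
    (h : ∀ᶠ n in atTop, ∀ ω, ω ∉ s n → X n ω = Y n ω) : TendstoZeroInProb P Y := by
  intro δ hδ
  refine squeeze_zero' (.of_forall fun _ => measureReal_nonneg) ?_ (by simpa using (hX δ hδ).add hs)
  filter_upwards [h] with n hn
  refine (measureReal_mono (s₂ := {ω | δ ≤ |X n ω|} ∪ s n) fun ω hω => ?_).trans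
    (measureReal_union_le _ _)
  by_cases hxy : ω ∈ s n
  · exact .inr hxy
  · exact .inl (by simpa [hn ω hxy] using hω)

theorem TendstoZeroInProb.add (hX : TendstoZeroInProb P X) (hY : TendstoZeroInProb P Y) :
    TendstoZeroInProb P fun n ω => X n ω + Y n ω := by
  intro δ hδ
  refine squeeze_zero (fun _ => measureReal_nonneg) (fun n => ?_)
    (by simpa using (hX (δ / 2) (by linarith)).add (hY (δ / 2) (by linarith)))
  refine (measureReal_mono (s₂ := {ω | δ / 2 ≤ |X n ω|} ∪ {ω | δ / 2 ≤ |Y n ω|})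
    fun ω (hω : δ ≤ |X n ω + Y n ω|) => ?_).trans (measureReal_union_le _ _)
  by_contra hc
  simp only [Set.mem_union, Set.mem_ofPred_eq, not_or, not_le] at hc
  linarith [abs_add_le (X n ω) (Y n ω)]

theorem TendstoZeroInProb.neg (hX : TendstoZeroInProb P X) :
    TendstoZeroInProb P fun n ω => -X n ω :=
  hX.mono (.of_forall fun n ω => by simp)

theorem TendstoZeroInProb.sub (hX : TendstoZeroInProb P X) (hY : TendstoZeroInProb P Y) :
    TendstoZeroInProb P fun n ω => X n ω - Y n ω := by
  simpa [sub_eq_add_neg] using hX.add hY.neg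

omit [∀ n, IsProbabilityMeasure (P n)] in
theorem tendstoZeroInProb_of_tendsto {c : ℕ → ℝ} (hc : Tendsto c atTop (𝓝 0)) :
    TendstoZeroInProb P fun n _ => c n := by
  rw [tendstoZeroInProb_iff]
  intro δ hδ η hη
  have : Tendsto (fun n => |c n|) atTop (𝓝 0) := by simpa using hc.abs
  filter_upwards [this.eventually (gt_mem_nhds hδ)] with n hn
  simp [not_le.2 hn, hη.le]

theorem BoundedInProb.add (hX : BoundedInProb P X) (hY : BoundedInProb P Y) :
    BoundedInProb P fun n ω => X n ω + Y n ω := by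
  intro η hη
  obtain ⟨M, hM, h1⟩ := hX (η / 2) (by linarith)
  obtain ⟨N, hN, h2⟩ := hY (η / 2) (by linarith)
  refine ⟨M + N, by linarith, ?_⟩
  filter_upwards [h1, h2] with n h1 h2
  refine (measureReal_mono (s₂ := {ω | M ≤ |X n ω|} ∪ {ω | N ≤ |Y n ω|})
    fun ω (hω : M + N ≤ |X n ω + Y n ω|) => ?_).trans
    ((measureReal_union_le _ _).trans (by linarith))
  by_contra hc
  simp only [Set.mem_union, Set.mem_ofPred_eq, not_or, not_le] at hc
  linarith [abs_add_le (X n ω) (Y n ω)]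

theorem BoundedInProb.mul (hX : BoundedInProb P X) (hY : BoundedInProb P Y) :
    BoundedInProb P fun n ω => X n ω * Y n ω := by
  intro η hη
  obtain ⟨M, hM, h1⟩ := hX (η / 2) (by linarith)
  obtain ⟨N, hN, h2⟩ := hY (η / 2) (by linarith)
  refine ⟨M * N, by positivity, ?_⟩
  filter_upwards [h1, h2] with n h1 h2
  refine (measureReal_mono (s₂ := {ω | M ≤ |X n ω|} ∪ {ω | N ≤ |Y n ω|})
    fun ω (hω : M * N ≤ |X n ω * Y n ω|) => ?_).trans
    ((measureReal_union_le _ _).trans (by linarith))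
  by_contra hc
  simp only [Set.mem_union, Set.mem_ofPred_eq, not_or, not_le] at hc
  rw [abs_mul] at hω
  exact absurd hω (not_le.2 (mul_lt_mul'' hc.1 hc.2 (abs_nonneg _) (abs_nonneg _)))

theorem TendstoZeroInProb.mul_bounded (hX : TendstoZeroInProb P X) (hY : BoundedInProb P Y) :
    TendstoZeroInProb P fun n ω => X n ω * Y n ω := by
  rw [tendstoZeroInProb_iff] at hX ⊢
  intro δ hδ η hη
  obtain ⟨N, hN, h2⟩ := hY (η / 2) (by linarith)
  filter_upwards [hX (δ / N) (by positivity) (η / 2) (by linarith), h2] with n h1 h2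
  refine (measureReal_mono (s₂ := {ω | δ / N ≤ |X n ω|} ∪ {ω | N ≤ |Y n ω|})
    fun ω (hω : δ ≤ |X n ω * Y n ω|) => ?_).trans
    ((measureReal_union_le _ _).trans (by linarith))
  by_contra hc
  simp only [Set.mem_union, Set.mem_ofPred_eq, not_or, not_le] at hc
  rw [abs_mul] at hω
  have := mul_lt_mul'' hc.1 hc.2 (abs_nonneg _) (abs_nonneg _)
  rw [div_mul_cancel₀ _ hN.ne'] at this
  linarith

theorem BoundedInProb.mul_tendstoZero (hX : BoundedInProb P X) (hY : TendstoZeroInProb P Y) :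
    TendstoZeroInProb P fun n ω => X n ω * Y n ω := by
  simpa [mul_comm] using hY.mul_bounded hX

omit [∀ n, IsProbabilityMeasure (P n)] in
theorem boundedInProb_of_tendsto {c : ℕ → ℝ} {a : ℝ} (hc : Tendsto c atTop (𝓝 a)) :
    BoundedInProb P fun n _ => c n := by
  intro η hη
  refine ⟨|a| + 1, by positivity, ?_⟩
  filter_upwards [hc.abs.eventually (gt_mem_nhds (lt_add_one |a|))] with n hn
  simp [not_le.2 hn, hη.le]

omit [∀ n, IsProbabilityMeasure (P n)] in
theorem boundedInProb_const (c : ℝ) : BoundedInProb P fun _ _ => c :=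
  boundedInProb_of_tendsto tendsto_const_nhds

theorem TendstoZeroInProb.sum {ι : Type*} (s : Finset ι) {X : ι → ∀ n, Ω n → ℝ}
    (h : ∀ i ∈ s, TendstoZeroInProb P (X i)) :
    TendstoZeroInProb P fun n ω => ∑ i ∈ s, X i n ω := by
  classical
  induction s using Finset.induction_on with
  | empty => simpa using tendstoZeroInProb_of_tendsto (P := P) (tendsto_const_nhds (x := (0 : ℝ)))
  | insert a s ha ih =>
    simp only [Finset.sum_insert ha]
    exact (h a (by simp)).add (ih fun i hi => h i (by simp [hi]))

theorem BoundedInProb.sum {ι : Type*} (s : Finset ι) {X : ι → ∀ n, Ω n → ℝ}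
    (h : ∀ i ∈ s, BoundedInProb P (X i)) :
    BoundedInProb P fun n ω => ∑ i ∈ s, X i n ω := by
  classical
  induction s using Finset.induction_on with
  | empty => simpa using boundedInProb_const (P := P) (0 : ℝ)
  | insert a s ha ih =>
    simp only [Finset.sum_insert ha]
    exact (h a (by simp)).add (ih fun i hi => h i (by simp [hi]))

omit [∀ n, IsProbabilityMeasure (P n)] in
theorem tendstoZeroInProb_of_integral_abs {b : ℕ → ℝ} (hint : ∀ n, Integrable (X n) (P n))
    (hle : ∀ᶠ n in atTop, ∫ ω, |X n ω| ∂P n ≤ b n) (hb : Tendsto b atTop (𝓝 0)) :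
    TendstoZeroInProb P X := by
  intro δ hδ
  refine squeeze_zero' (.of_forall fun _ => measureReal_nonneg) ?_
    (by simpa using hb.div_const δ)
  filter_upwards [hle] with n hn
  rw [le_div_iff₀ hδ, mul_comm]
  exact (mul_meas_ge_le_integral_of_nonneg (.of_forall fun ω => abs_nonneg _)
    (hint n).abs δ).trans hn

theorem tendstoZeroInProb_of_integral_sq {b : ℕ → ℝ} (hint : ∀ n, MemLp (X n) 2 (P n))
    (hle : ∀ᶠ n in atTop, ∫ ω, X n ω ^ 2 ∂P n ≤ b n) (hb : Tendsto b atTop (𝓝 0)) :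
    TendstoZeroInProb P X := by
  intro δ hδ
  refine squeeze_zero' (.of_forall fun _ => measureReal_nonneg) ?_
    (by simpa using hb.div_const (δ ^ 2))
  filter_upwards [hle] with n hn
  rw [le_div_iff₀ (by positivity), mul_comm]
  refine le_trans ?_ ((mul_meas_ge_le_integral_of_nonneg (.of_forall fun ω => sq_nonneg _)
    (hint n).integrable_sq (δ ^ 2)).trans hn)
  refine mul_le_mul_of_nonneg_left (measureReal_mono fun ω (hω : δ ≤ |X n ω|) => ?_) (by positivity)
  simpa using pow_le_pow_left₀ hδ.le hω 2

theorem boundedInProb_of_integral_sq {C : ℝ} (hint : ∀ n, MemLp (X n) 2 (P n))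
    (hle : ∀ n, ∫ ω, X n ω ^ 2 ∂P n ≤ C) : BoundedInProb P X := by
  intro η hη
  have hC : 0 ≤ C := (integral_nonneg fun ω => sq_nonneg (X 0 ω)).trans (hle 0)
  -- Chebyshev with threshold (C + 1) / η for the square; the added 1 keeps it positive when C = 0.
  refine ⟨√((C + 1) / η), by positivity, .of_forall fun n => ?_⟩
  have h := (mul_meas_ge_le_integral_of_nonneg (.of_forall fun ω => sq_nonneg _)
    (hint n).integrable_sq ((C + 1) / η)).trans (hle n)
  have h' : (P n).real {ω | √((C + 1) / η) ≤ |X n ω|} ≤ (P n).real {ω | (C + 1) / η ≤ X n ω ^ 2} :=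
    measureReal_mono fun ω (hω : √((C + 1) / η) ≤ |X n ω|) => by
      simpa [Real.sqrt_le_left, Real.sq_sqrt (show 0 ≤ (C + 1) / η by positivity)] using
        pow_le_pow_left₀ (Real.sqrt_nonneg _) hω 2
  refine h'.trans ?_
  rw [div_mul_eq_mul_div, div_le_iff₀ hη] at h
  have : (C + 1) * (P n).real {ω | (C + 1) / η ≤ X n ω ^ 2} ≤ (C + 1) * η := by nlinarith
  exact le_of_mul_le_mul_left this (by linarith)

/-- The continuous mapping theorem for convergence in probability to a constant vector. -/
theorem TendstoZeroInProb.comp_continuousAt {ι : Type*} [Fintype ι] {Z : ∀ n, Ω n → ι → ℝ}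
    {z : ι → ℝ} (hZ : ∀ i, TendstoZeroInProb P fun n ω => Z n ω i - z i)
    {g : (ι → ℝ) → ℝ} (hg : ContinuousAt g z) :
    TendstoZeroInProb P fun n ω => g (Z n ω) - g z := by
  intro δ hδ
  obtain ⟨r, hr, h⟩ := Metric.continuousAt_iff.1 hg δ hδ
  have hsum : Tendsto (fun n => ∑ i, (P n).real {ω | r ≤ |Z n ω i - z i|}) atTop (𝓝 0) := by
    simpa using tendsto_finsetSum Finset.univ fun i _ => hZ i r hr
  refine squeeze_zero (fun _ => measureReal_nonneg) (fun n => ?_) hsum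
  refine (measureReal_mono (s₂ := ⋃ i, {ω | r ≤ |Z n ω i - z i|})
    fun ω (hω : δ ≤ |g (Z n ω) - g z|) => ?_).trans (measureReal_iUnion_fintype_le _)
  by_contra hc
  simp only [Set.mem_iUnion, Set.mem_ofPred_eq, not_exists, not_le] at hc
  have : dist (Z n ω) z < r := (dist_pi_lt_iff hr).2 fun i => by simpa [Real.dist_eq] using hc i
  have := h this
  rw [Real.dist_eq] at this
  linarith

/-! ### Matrices whose entries are small or bounded in probability -/

/-- Entrywise convergence to zero in probability. -/
def MatTendstoZeroInProb {α β : Type*} (P : ∀ n, Measure (Ω n))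
    (X : ∀ n, Ω n → Matrix α β ℝ) : Prop :=
  ∀ i j, TendstoZeroInProb P fun n ω => X n ω i j

/-- Entrywise boundedness in probability. -/
def MatBoundedInProb {α β : Type*} (P : ∀ n, Measure (Ω n))
    (X : ∀ n, Ω n → Matrix α β ℝ) : Prop :=
  ∀ i j, BoundedInProb P fun n ω => X n ω i j

variable {α β γ : Type*}

omit [∀ n, IsProbabilityMeasure (P n)] in
theorem MatTendstoZeroInProb.bounded {U : ∀ n, Ω n → Matrix α β ℝ}
    (h : MatTendstoZeroInProb P U) : MatBoundedInProb P U := fun i j => (h i j).boundedInProb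

omit [∀ n, IsProbabilityMeasure (P n)] in
theorem MatTendstoZeroInProb.transpose {U : ∀ n, Ω n → Matrix α β ℝ}
    (h : MatTendstoZeroInProb P U) : MatTendstoZeroInProb P fun n ω => (U n ω)ᵀ :=
  fun i j => h j i

theorem MatTendstoZeroInProb.congr {U V : ∀ n, Ω n → Matrix α β ℝ}
    (hU : MatTendstoZeroInProb P U) {s : ∀ n, Set (Ω n)}
    (hs : Tendsto (fun n => (P n).real (s n)) atTop (𝓝 0))
    (h : ∀ᶠ n in atTop, ∀ ω, ω ∉ s n → U n ω = V n ω) : MatTendstoZeroInProb P V :=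
  fun i j => (hU i j).congr hs (h.mono fun _ hn ω hω => by rw [hn ω hω])

theorem MatTendstoZeroInProb.add {U V : ∀ n, Ω n → Matrix α β ℝ}
    (hU : MatTendstoZeroInProb P U) (hV : MatTendstoZeroInProb P V) :
    MatTendstoZeroInProb P fun n ω => U n ω + V n ω := fun i j => (hU i j).add (hV i j)

theorem MatBoundedInProb.add {U V : ∀ n, Ω n → Matrix α β ℝ}
    (hU : MatBoundedInProb P U) (hV : MatBoundedInProb P V) :
    MatBoundedInProb P fun n ω => U n ω + V n ω := fun i j => (hU i j).add (hV i j)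

omit [∀ n, IsProbabilityMeasure (P n)] in
theorem matBoundedInProb_const (M : Matrix α β ℝ) : MatBoundedInProb P fun _ _ => M :=
  fun i j => boundedInProb_const (M i j)

omit [∀ n, IsProbabilityMeasure (P n)] in
theorem matTendstoZeroInProb_of_tendsto {L : ℕ → Matrix α β ℝ} (h : Tendsto L atTop (𝓝 0)) :
    MatTendstoZeroInProb P fun n _ => L n := fun i j =>
  tendstoZeroInProb_of_tendsto ((tendsto_pi_nhds.1 (tendsto_pi_nhds.1 h i)) j)

theorem MatTendstoZeroInProb.mul_bounded [Fintype β] {U : ∀ n, Ω n → Matrix α β ℝ}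
    {V : ∀ n, Ω n → Matrix β γ ℝ} (hU : MatTendstoZeroInProb P U) (hV : MatBoundedInProb P V) :
    MatTendstoZeroInProb P fun n ω => U n ω * V n ω := fun i j => by
  simp only [Matrix.mul_apply]
  exact TendstoZeroInProb.sum _ fun k _ => (hU i k).mul_bounded (hV k j)

theorem MatBoundedInProb.mul_tendstoZero [Fintype β] {U : ∀ n, Ω n → Matrix α β ℝ}
    {V : ∀ n, Ω n → Matrix β γ ℝ} (hU : MatBoundedInProb P U) (hV : MatTendstoZeroInProb P V) :
    MatTendstoZeroInProb P fun n ω => U n ω * V n ω := fun i j => by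
  simp only [Matrix.mul_apply]
  exact TendstoZeroInProb.sum _ fun k _ => (hU i k).mul_tendstoZero (hV k j)

theorem MatBoundedInProb.mul [Fintype β] {U : ∀ n, Ω n → Matrix α β ℝ}
    {V : ∀ n, Ω n → Matrix β γ ℝ} (hU : MatBoundedInProb P U) (hV : MatBoundedInProb P V) :
    MatBoundedInProb P fun n ω => U n ω * V n ω := fun i j => by
  simp only [Matrix.mul_apply]
  exact BoundedInProb.sum _ fun k _ => (hU i k).mul (hV k j)

theorem MatBoundedInProb.smul_tendstoZero {c : ∀ n, Ω n → ℝ} {U : ∀ n, Ω n → Matrix α β ℝ}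
    (hU : MatBoundedInProb P U) (hc : TendstoZeroInProb P c) :
    MatTendstoZeroInProb P fun n ω => c n ω • U n ω := fun i j => hc.mul_bounded (hU i j)

/-- The inverse of a matrix converging in probability to an invertible matrix is bounded in
probability, and the matrix is invertible with probability tending to one. -/
theorem MatTendstoZeroInProb.inv {K : ℕ} {S : ∀ n, Ω n → Matrix (Fin K) (Fin K) ℝ}
    {M : Matrix (Fin K) (Fin K) ℝ} (hM : M.det ≠ 0)
    (h : MatTendstoZeroInProb P fun n ω => S n ω - M) :
    MatBoundedInProb P (fun n ω => (S n ω)⁻¹) ∧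
      Tendsto (fun n => (P n).real {ω | (S n ω).det = 0}) atTop (𝓝 0) := by
  -- A matrix is read as a vector indexed by pairs, so that the continuous mapping theorem applies
  -- to functions of matrices continuous at M.
  have key : ∀ g : Matrix (Fin K) (Fin K) ℝ → ℝ, ContinuousAt g M →
      TendstoZeroInProb P fun n ω => g (S n ω) - g M := by
    intro g hg
    obtain ⟨cur, hcur, hcont⟩ : ∃ cur : (Fin K × Fin K → ℝ) → Matrix (Fin K) (Fin K) ℝ,
        (∀ N : Matrix (Fin K) (Fin K) ℝ, cur (fun q => N q.1 q.2) = N) ∧ Continuous cur :=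
      ⟨fun w => Matrix.of fun i j => w (i, j), fun N => rfl,
        continuous_matrix fun i j => continuous_apply _⟩
    have hg' : ContinuousAt (fun w => g (cur w)) fun q => M q.1 q.2 :=
      ContinuousAt.comp (by rwa [hcur]) hcont.continuousAt
    have hq : ∀ q : Fin K × Fin K, TendstoZeroInProb P fun n ω => S n ω q.1 q.2 - M q.1 q.2 :=
      fun q => by simpa only [Matrix.sub_apply] using h q.1 q.2
    have := TendstoZeroInProb.comp_continuousAt (P := P) (ι := Fin K × Fin K)
      (Z := fun n ω q => S n ω q.1 q.2)
      (z := fun q => M q.1 q.2) hq (g := fun w => g (cur w)) hg'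
    simpa only [hcur] using this
  constructor
  · intro i j
    -- The formula det⁻¹ · adjugate also holds at singular matrices, where both sides are 0, so it
    -- describes the inverse on a full neighbourhood of M.
    have hinv : ContinuousAt (fun N : Matrix (Fin K) (Fin K) ℝ => N⁻¹ i j) M := by
      have hdet : ContinuousAt (fun N : Matrix (Fin K) (Fin K) ℝ => N.det) M :=
        (Continuous.matrix_det continuous_id).continuousAt
      have hadj : ContinuousAt (fun N : Matrix (Fin K) (Fin K) ℝ => N.adjugate i j) M :=
        ((Continuous.matrix_adjugate continuous_id).matrix_elem i j).continuousAt
      have h2 : ContinuousAt (fun N : Matrix (Fin K) (Fin K) ℝ => N.det⁻¹ * N.adjugate i j) M :=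
        (hdet.inv₀ hM).mul hadj
      simpa only [Matrix.inv_def, Ring.inverse_eq_inv', Matrix.smul_apply, smul_eq_mul] using h2
    have := (key _ hinv).boundedInProb.add (boundedInProb_const (M⁻¹ i j))
    simpa using this
  -- Where det S = 0 the determinant misses its limit by exactly |det M|, which serves as the
  -- threshold.
  · have := key _ (Continuous.matrix_det continuous_id).continuousAt |M.det| (abs_pos.2 hM)
    refine squeeze_zero (fun _ => measureReal_nonneg) (fun n => ?_) this
    refine measureReal_mono fun ω (hω : (S n ω).det = 0) => ?_
    simp [hω]

/-- **Slutsky's lemma** along a sequence of probability spaces: variables whose distance tends to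
zero in probability have the same limit in distribution. -/
theorem tendstoInDistribution_of_norm_sub {E : Type*} [NormedAddCommGroup E]
    [InnerProductSpace ℝ E] [FiniteDimensional ℝ E] [MeasurableSpace E] [BorelSpace E]
    {Ω' : Type*} [MeasurableSpace Ω'] {P' : Measure Ω'} [IsProbabilityMeasure P']
    {U V : ∀ n, Ω n → E} {Z : Ω' → E} (hU : TendstoInDistribution U atTop Z P P')
    (hV : ∀ n, AEMeasurable (V n) (P n))
    (h : TendstoZeroInProb P fun n ω => ‖V n ω - U n ω‖) :
    TendstoInDistribution V atTop Z P P' := by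
  refine ⟨hV, hU.aemeasurable_limit, ProbabilityMeasure.tendsto_iff_tendsto_charFun.2 fun t => ?_⟩
  have h0 := ProbabilityMeasure.tendsto_iff_tendsto_charFun.1 hU.tendsto t
  simp only [ProbabilityMeasure.coe_mk] at h0 ⊢
  suffices hd : Tendsto (fun n => charFun ((P n).map (V n)) t - charFun ((P n).map (U n)) t)
      atTop (𝓝 0) by simpa using hd.add h0
  rw [Metric.tendsto_atTop]
  -- Off an event of probability below e / 8 the phases differ by at most δ‖t‖ < e / 2; on it the
  -- exponentials differ by at most 2. The total is below 3e / 4.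
  intro e he
  obtain ⟨δ, hδ0, hδt⟩ : ∃ δ : ℝ, 0 < δ ∧ δ * ‖t‖ < e / 2 := by
    refine ⟨e / (2 * (‖t‖ + 1)), by positivity, ?_⟩
    rw [div_mul_eq_mul_div, div_lt_iff₀ (by positivity)]
    nlinarith [norm_nonneg t]
  obtain ⟨n₀, hn₀⟩ := eventually_atTop.1 ((h δ hδ0).eventually (gt_mem_nhds (show 0 < e / 8 by linarith)))
  refine ⟨n₀, fun n hn => ?_⟩
  have hn := hn₀ n hn
  have hUn := hU.forall_aemeasurable n
  have hbound : ∀ x : ℝ, ‖Complex.exp (x * Complex.I)‖ = 1 := Complex.norm_exp_ofReal_mul_I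
  have meas : ∀ {W : Ω n → E}, AEMeasurable W (P n) →
      Integrable (fun ω => Complex.exp ((inner ℝ (W ω) t : ℝ) * Complex.I)) (P n) := fun {W} hW => by
    refine Integrable.of_bound (C := 1) ?_ (.of_forall fun ω => (hbound _).le)
    have : AEMeasurable (fun ω => (inner ℝ (W ω) t : ℝ)) (P n) :=
      (measurable_id.inner_const (c := t)).comp_aemeasurable hW
    exact AEMeasurable.aestronglyMeasurable
      (Complex.measurable_exp.comp_aemeasurable
        ((Complex.measurable_ofReal.comp_aemeasurable this).mul_const _))
  have hcf : ∀ {W : Ω n → E}, AEMeasurable W (P n) → charFun ((P n).map W) t =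
      ∫ ω, Complex.exp ((inner ℝ (W ω) t : ℝ) * Complex.I) ∂P n := fun {W} hW => by
    rw [charFun_apply, integral_map hW]
    exact Measurable.aestronglyMeasurable (by fun_prop)
  rw [dist_zero_right, hcf (hV n), hcf hUn, ← integral_sub (meas (hV n)) (meas hUn)]
  -- A measurable hull of the exceptional event has the same probability, and its indicator can be
  -- integrated.
  set T := toMeasurable (P n) {ω | δ ≤ |‖V n ω - U n ω‖|} with hT
  have hTm : MeasurableSet T := measurableSet_toMeasurable _ _
  have hTr : (P n).real T < e / 8 := by
    simpa [hT, measureReal_def, measure_toMeasurable] using hn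
  have hpt : ∀ ω, ‖Complex.exp ((inner ℝ (V n ω) t : ℝ) * Complex.I)
      - Complex.exp ((inner ℝ (U n ω) t : ℝ) * Complex.I)‖
      ≤ δ * ‖t‖ + T.indicator (fun _ => 2) ω := by
    intro ω
    by_cases hω : ω ∈ T
    · rw [Set.indicator_of_mem hω]
      have := norm_sub_le (Complex.exp ((inner ℝ (V n ω) t : ℝ) * Complex.I))
        (Complex.exp ((inner ℝ (U n ω) t : ℝ) * Complex.I))
      rw [hbound, hbound] at this
      have : 0 ≤ δ * ‖t‖ := by positivity
      linarith
    · rw [Set.indicator_of_notMem hω, add_zero]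
      have hω' : ‖V n ω - U n ω‖ < δ := by
        by_contra hc
        exact hω (subset_toMeasurable _ _ (by simpa using not_lt.1 hc))
      have hfac : Complex.exp ((inner ℝ (V n ω) t : ℝ) * Complex.I)
          - Complex.exp ((inner ℝ (U n ω) t : ℝ) * Complex.I)
          = Complex.exp ((inner ℝ (U n ω) t : ℝ) * Complex.I) *
            (Complex.exp (Complex.I * (inner ℝ (V n ω - U n ω) t : ℝ)) - 1) := by
        rw [mul_sub, mul_one, ← Complex.exp_add]
        congr 2
        rw [inner_sub_left]
        push_cast
        ring
      rw [hfac, norm_mul, hbound, one_mul]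
      refine Real.norm_exp_I_mul_ofReal_sub_one_le.trans ?_
      exact (norm_inner_le_norm _ _).trans (mul_le_mul_of_nonneg_right hω'.le (norm_nonneg _))
  calc _ ≤ ∫ ω, (δ * ‖t‖ + T.indicator (fun _ => (2 : ℝ)) ω) ∂P n := by
        refine norm_integral_le_of_norm_le ?_ (.of_forall hpt)
        exact (integrable_const _).add ((integrable_const _).indicator hTm)
    _ = δ * ‖t‖ + 2 * (P n).real T := by
        rw [integral_add (integrable_const _) ((integrable_const _).indicator hTm),
          integral_indicator hTm]
        simp [mul_comm]
    _ < e := by linarith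

end StochasticOrder

/-! ### Second moments of normalized i.i.d. sums -/

section NormalizedSum

variable {n : ℕ} {Ω Ω₀ 𝓧 : Type*} [MeasurableSpace Ω] [MeasurableSpace Ω₀] [MeasurableSpace 𝓧]
  {P : Measure Ω} {P₀ : Measure Ω₀} {z : Fin n → Ω → 𝓧} {ζ : Ω₀ → 𝓧} {φ : 𝓧 → ℝ}

/-- The normalized sum `n^{-1/2} ∑ φ(zᵢ)`. -/
noncomputable def normSum (φ : 𝓧 → ℝ) (z : Fin n → Ω → 𝓧) (ω : Ω) : ℝ :=
  (√(n : ℝ))⁻¹ * ∑ i, φ (z i ω)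

theorem memLp_normSum (hid : ∀ i, IdentDistrib (z i) ζ P P₀) (hφ : Measurable φ)
    (h2 : MemLp (fun ω => φ (ζ ω)) 2 P₀) : MemLp (normSum φ z) 2 P :=
  (memLp_finsetSum _ fun i _ => ((hid i).comp hφ).memLp_iff.2 h2).const_mul _

/-- The centered terms are independent, so the variance of the sum is n times that of one term, and
the factor 1/n cancels it. Equality can fail only for n = 0, where the sum is empty. -/
theorem integral_normSum_sq_le [IsProbabilityMeasure P] [IsProbabilityMeasure P₀]
    (hind : iIndepFun z P) (hid : ∀ i, IdentDistrib (z i) ζ P P₀)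
    (hφ : Measurable φ) (h2 : MemLp (fun ω => φ (ζ ω)) 2 P₀) (h0 : ∫ ω, φ (ζ ω) ∂P₀ = 0) :
    ∫ ω, normSum φ z ω ^ 2 ∂P ≤ ∫ ω, φ (ζ ω) ^ 2 ∂P₀ := by
  have hm : ∀ i, MemLp (fun ω => φ (z i ω)) 2 P := fun i => ((hid i).comp hφ).memLp_iff.2 h2
  have hmean : ∀ i, ∫ ω, φ (z i ω) ∂P = 0 := fun i => ((hid i).comp hφ).integral_eq.trans h0
  have hs : ∫ ω, (∑ i, φ (z i ω)) ^ 2 ∂P = n * ∫ ω, φ (ζ ω) ^ 2 ∂P₀ := by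
    have hv := IndepFun.variance_sum (μ := P) (X := fun i ω => φ (z i ω)) (s := Finset.univ)
      (fun i _ => hm i) fun i _ j _ hij => (hind.comp (fun _ => φ) fun _ => hφ).indepFun hij
    have e : (∑ i, fun ω => φ (z i ω)) = fun ω => ∑ i, φ (z i ω) := by ext; simp
    have hvi : ∀ i, Var[fun ω => φ (z i ω); P] = ∫ ω, φ (ζ ω) ^ 2 ∂P₀ := fun i => by
      rw [variance_of_integral_eq_zero (hm i).aemeasurable (hmean i)]
      exact ((hid i).comp (hφ.pow_const 2)).integral_eq
    rw [e, variance_of_integral_eq_zero (memLp_finsetSum _ fun i _ => hm i).aemeasurable] at hv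
    · simpa [hvi] using hv
    · rw [integral_finsetSum _ fun i _ => (hm i).integrable one_le_two]
      simp [hmean]
  have hnn : 0 ≤ ∫ ω, φ (ζ ω) ^ 2 ∂P₀ := integral_nonneg fun _ => sq_nonneg _
  simp only [normSum, mul_pow, inv_pow, Nat.cast_nonneg, Real.sq_sqrt]
  rw [integral_const_mul, hs]
  rcases Nat.eq_zero_or_pos n with rfl | hn
  · simpa using hnn
  · have : (n : ℝ) ≠ 0 := by positivity
    rw [inv_mul_cancel_left₀ this]

end NormalizedSum

/-! ### Central limit theorem for row-wise i.i.d. arrays -/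

section CentralLimit

variable {Ω₀ 𝓧 : Type*} [MeasurableSpace Ω₀] [MeasurableSpace 𝓧]
  {P₀ : Measure Ω₀} [IsProbabilityMeasure P₀] {ζ : Ω₀ → 𝓧}

/-- Dividing ξ by its standard deviation reduces to the normalized scalar limit theorem, read at
frequency √v. The case v = 0 cannot be normalized and is separate; it does occur, since G may be
singular. -/
theorem tendsto_charFun_pow {ξ : Ω₀ → ℝ} (hξ : MemLp ξ 2 P₀) (h0 : ∫ ω, ξ ω ∂P₀ = 0) :
    Tendsto (fun n : ℕ => charFun (P₀.map ξ) (√(n : ℝ))⁻¹ ^ n) atTop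
      (𝓝 (Complex.exp (-(∫ ω, ξ ω ^ 2 ∂P₀ : ℝ) / 2))) := by
  set v := ∫ ω, ξ ω ^ 2 ∂P₀ with hv
  have hv0 : 0 ≤ v := integral_nonneg fun _ => sq_nonneg _
  rcases hv0.eq_or_lt with h | h
  · have hz : ξ =ᵐ[P₀] fun _ => 0 := by
      have := (integral_eq_zero_iff_of_nonneg (fun ω => sq_nonneg (ξ ω)) hξ.integrable_sq).1
        (hv ▸ h.symm)
      filter_upwards [this] with ω hω
      simpa using hω
    rw [Measure.map_congr hz, ← h]
    simp
  · have hsv : √v ≠ 0 := (Real.sqrt_pos.2 h).ne'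
    have := tendsto_charFun_inv_sqrt_mul_pow (P := P₀) (X := fun ω => (√v)⁻¹ * ξ ω)
      (hξ.aemeasurable.const_mul _) (by rw [integral_const_mul, h0, mul_zero])
      (by
        simp only [Pi.pow_apply, mul_pow, inv_pow, Real.sq_sqrt hv0]
        rw [integral_const_mul, ← hv, inv_mul_cancel₀ h.ne']) (√v)
    have e : ∀ n : ℕ, charFun (P₀.map fun ω => (√v)⁻¹ * ξ ω) ((√(n : ℝ))⁻¹ * √v)
        = charFun (P₀.map ξ) (√(n : ℝ))⁻¹ := fun n => by
      rw [charFun_map_mul_comp hξ.aemeasurable, mul_comm, mul_assoc, mul_inv_cancel₀ hsv, mul_one]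
    simp only [e] at this
    convert! this using 3
    rw [← Complex.ofReal_pow, Real.sq_sqrt hv0]

/-- The **central limit theorem** for row-wise i.i.d. arrays of random vectors whose common law
does not depend on the row. -/
theorem tendstoInDistribution_normSum {ι : Type*} [Fintype ι] [DecidableEq ι]
    {Ω : ℕ → Type*} [∀ n, MeasurableSpace (Ω n)] {P : ∀ n, Measure (Ω n)}
    [∀ n, IsProbabilityMeasure (P n)] {z : ∀ n, Fin n → Ω n → 𝓧}
    (hind : ∀ n, iIndepFun (z n) (P n)) (hid : ∀ n i, IdentDistrib (z n i) ζ (P n) P₀)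
    {φ : 𝓧 → EuclideanSpace ℝ ι} (hφ : Measurable φ)
    {G : Matrix ι ι ℝ} (hG : G.PosSemidef)
    (h2 : ∀ t, MemLp (fun ω => (inner ℝ (φ (ζ ω)) t : ℝ)) 2 P₀)
    (h0 : ∀ t, ∫ ω, (inner ℝ (φ (ζ ω)) t : ℝ) ∂P₀ = 0)
    (hv : ∀ t : EuclideanSpace ℝ ι,
      ∫ ω, (inner ℝ (φ (ζ ω)) t : ℝ) ^ 2 ∂P₀ = WithLp.ofLp t ⬝ᵥ G *ᵥ WithLp.ofLp t) :
    TendstoInDistribution (fun (n : ℕ) ω => (√(n : ℝ))⁻¹ • ∑ i, φ (z n i ω)) atTop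
      (id : EuclideanSpace ℝ ι → EuclideanSpace ℝ ι) P (multivariateGaussian 0 G) := by
  have hmeas : ∀ (n : ℕ) i, AEMeasurable (fun ω => φ (z n i ω)) (P n) :=
    fun n i => hφ.comp_aemeasurable (hid n i).aemeasurable_fst
  have hsm : ∀ n : ℕ, AEMeasurable (fun ω => ∑ i, φ (z n i ω)) (P n) :=
    fun n => Finset.aemeasurable_fun_sum _ fun i _ => hmeas n i
  refine ⟨fun n => (hsm n).fun_const_smul _, aemeasurable_id,
    ProbabilityMeasure.tendsto_iff_tendsto_charFun.2 fun t => ?_⟩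
  simp only [ProbabilityMeasure.coe_mk, Measure.map_id]
  rw [charFun_multivariateGaussian hG, ← hv t]
  have hφζ : AEMeasurable (fun ω => φ (ζ ω)) P₀ :=
    -- Row 0 is empty, so row 1 is the first to give information on ζ.
    hφ.comp_aemeasurable (hid 1 0).aemeasurable_snd
  -- Cramér–Wold: at t, the characteristic function of the sum is the n-th power of that of the
  -- scalar projection of φ(ζ) on t.
  have e : ∀ n : ℕ, charFun ((P n).map fun ω => (√(n : ℝ))⁻¹ • ∑ i, φ (z n i ω)) t
      = charFun (P₀.map fun ω => (inner ℝ (φ (ζ ω)) t : ℝ)) (√(n : ℝ))⁻¹ ^ n := fun n => by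
    have h1 : (P n).map (fun ω => (√(n : ℝ))⁻¹ • ∑ i, φ (z n i ω))
        = ((P n).map fun ω => ∑ i, φ (z n i ω)).map fun x => (√(n : ℝ))⁻¹ • x := by
      rw [AEMeasurable.map_map_of_aemeasurable (by fun_prop) (hsm n)]
      rfl
    rw [h1, charFun_map_smul, iIndepFun.charFun_map_fun_sum_eq_prod (hmeas n)
      ((hind n).comp (fun _ => φ) fun _ => hφ)]
    have h3 : ∀ i, (P n).map (fun ω => φ (z n i ω)) = P₀.map fun ω => φ (ζ ω) :=
      fun i => ((hid n i).comp hφ).map_eq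
    simp only [h3, Finset.prod_const, Finset.card_univ, Fintype.card_fin, Pi.pow_apply]
    congr 1
    rw [charFun_apply, charFun_apply, integral_map hφζ (by fun_prop),
      integral_map (h2 t).aemeasurable (by fun_prop)]
    simp [inner_smul_right, mul_comm]
  simp only [e]
  convert! tendsto_charFun_pow (h2 t) (h0 t) using 3
  simp [neg_div]

end CentralLimit

/-! ### Duplication matrix and congruences in vech coordinates -/

section HalfVectorization

variable {d : ℕ}

theorem exists_isSymm_vech_eq (v : VechIndex d → ℝ) :
    ∃ M : Matrix (Fin d) (Fin d) ℝ, M.IsSymm ∧ vech M = v := by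
  refine ⟨Matrix.of fun i j => v ⟨(min i j, max i j), min_le_max⟩, ?_, ?_⟩
  · ext i j
    simp [min_comm, max_comm]
  · funext r
    obtain ⟨⟨a, b⟩, h⟩ := r
    have h' : a ≤ b := h
    simp [vech, h']

/-- Every vector is the vech of a symmetric matrix, on which D returns the whole vec. Hence D is
injective, D'D is positive definite, and (D'D)⁻¹ is a genuine inverse. -/
theorem dupPinv_mul_dup (d : ℕ) : dupPinv d * dup d = 1 := by
  have hinj : Function.Injective ((dup d).mulVec) := by
    intro v w hvw
    obtain ⟨M, hM, rfl⟩ := exists_isSymm_vech_eq v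
    obtain ⟨N, hN, rfl⟩ := exists_isSymm_vech_eq w
    simp only [dup_mulVec_vech M hM, dup_mulVec_vech N hN, Matrix.vec_inj] at hvw
    rw [hvw]
  have hpd := Matrix.PosDef.conjTranspose_mul_self (dup d) hinj
  rw [Matrix.conjTranspose_eq_transpose_of_trivial] at hpd
  rw [dupPinv, Matrix.mul_assoc, Matrix.nonsing_inv_mul _ ((Matrix.isUnit_iff_isUnit_det _).1 hpd.isUnit)]

/-- The matrix of the linear map `vech M ↦ vech (A M A)` on symmetric matrices. -/
noncomputable def congrMat (A : Matrix (Fin d) (Fin d) ℝ) : Matrix (VechIndex d) (VechIndex d) ℝ :=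
  dupPinv d * (A ⊗ₖ A) * dup d

/-- AMA is again symmetric, so D turns its vech into vec(AMA) = (A ⊗ A) vec M, and P_D undoes D. -/
theorem vech_mul_mul {A M : Matrix (Fin d) (Fin d) ℝ} (hA : A.IsSymm) (hM : M.IsSymm) :
    vech (A * M * A) = congrMat A *ᵥ vech M := by
  have hs : (A * M * A).IsSymm := by
    rw [Matrix.IsSymm, Matrix.transpose_mul, Matrix.transpose_mul, hA.eq, hM.eq, Matrix.mul_assoc]
  calc vech (A * M * A) = (dupPinv d * dup d) *ᵥ vech (A * M * A) := by
        rw [dupPinv_mul_dup, Matrix.one_mulVec]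
    _ = congrMat A *ᵥ vech M := by
        rw [congrMat, ← Matrix.mulVec_mulVec, ← Matrix.mulVec_mulVec, ← Matrix.mulVec_mulVec,
          dup_mulVec_vech _ hs, dup_mulVec_vech _ hM, Matrix.kronecker_mulVec_vec, hA.eq]

/-- Since A ⊗ A is symmetric, G is a congruence of H: this gives its positivity and identifies it as
the covariance of the transformed vech U. -/
theorem Gmat_eq {A : Matrix (Fin d) (Fin d) ℝ} (hA : A.IsSymm)
    (H : Matrix (VechIndex d) (VechIndex d) ℝ) :
    Gmat A H = congrMat A * H * (congrMat A)ᵀ := by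
  have hk : (A ⊗ₖ A)ᵀ = A ⊗ₖ A := by
    rw [← Matrix.kroneckerMap_transpose, hA.eq]
  rw [Gmat, congrMat, Matrix.transpose_mul, Matrix.transpose_mul, hk]
  simp only [Matrix.mul_assoc]

end HalfVectorization

/-! ### Covariance matrices and fourth order cumulants -/

section Covariance

variable {Ω : Type*} [MeasurableSpace Ω] {P : Measure Ω} [IsProbabilityMeasure P]

/-- This serves twice: it makes covariance matrices positive semidefinite, and it supplies the
variances of the projections in the central limit theorem. -/
theorem integral_dotProduct_centered_sq {ι : Type*} [Fintype ι] {X : Ω → ι → ℝ}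
    (hX : ∀ i, MemLp (fun ω => X ω i) 2 P) (a : ι → ℝ) :
    ∫ ω, (∑ i, (X ω i - ∫ ω', X ω' i ∂P) * a i) ^ 2 ∂P = a ⬝ᵥ covMat X P *ᵥ a := by
  have hXc : ∀ i, MemLp (fun ω => X ω i - ∫ ω', X ω' i ∂P) 2 P :=
    fun i => (hX i).sub (memLp_const _)
  have hpt : ∀ ω, (∑ i, (X ω i - ∫ ω', X ω' i ∂P) * a i) ^ 2 = ∑ i, ∑ j,
      a i * a j * ((X ω i - ∫ ω', X ω' i ∂P) * (X ω j - ∫ ω', X ω' j ∂P)) := fun ω => by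
    rw [sq, Finset.sum_mul_sum]
    exact Finset.sum_congr rfl fun i _ => Finset.sum_congr rfl fun j _ => by ring
  have hint : ∀ i j, Integrable (fun ω => a i * a j *
      ((X ω i - ∫ ω', X ω' i ∂P) * (X ω j - ∫ ω', X ω' j ∂P))) P :=
    fun i j => ((hXc i).integrable_mul (hXc j)).const_mul _
  simp only [hpt]
  rw [integral_finsetSum _ fun i _ => integrable_finsetSum _ fun j _ => hint i j]
  simp only [dotProduct, Matrix.mulVec, Finset.mul_sum]
  refine Finset.sum_congr rfl fun i _ => ?_
  rw [integral_finsetSum _ fun j _ => hint i j]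
  refine Finset.sum_congr rfl fun j _ => ?_
  rw [integral_const_mul]
  simp only [covMat, Matrix.of_apply, covariance]
  ring

theorem posSemidef_covMat {ι : Type*} [Fintype ι] {X : Ω → ι → ℝ}
    (hX : ∀ i, MemLp (fun ω => X ω i) 2 P) : (covMat X P).PosSemidef := by
  refine Matrix.PosSemidef.of_dotProduct_mulVec_nonneg (covMat_isHermitian X P) fun a => ?_
  rw [star_trivial, ← integral_dotProduct_centered_sq hX a]
  exact integral_nonneg fun _ => sq_nonneg _

variable {K : ℕ} {f : Ω → Fin K → ℝ}

omit [IsProbabilityMeasure P] in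
theorem memLp_two_mul {u v : Ω → ℝ} (hu : MemLp u 4 P) (hv : MemLp v 4 P) :
    MemLp (fun ω => u ω * v ω) 2 P := by
  have : ENNReal.HolderTriple 4 4 2 := ⟨by
    rw [← ENNReal.toReal_eq_toReal_iff' (by simp) (by simp), ENNReal.toReal_add (by simp) (by simp)]
    norm_num⟩
  exact MemLp.mul' (p := 4) (q := 4) hv hu

theorem memLp_two_outerProd (hf : ∀ k, MemLp (fun ω => f ω k) 4 P) (i j : Fin K) :
    MemLp (fun ω => outerProd f P ω i j) 2 P :=
  memLp_two_mul ((hf i).sub (memLp_const _)) ((hf j).sub (memLp_const _))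

/-- The covariance is m_ijkl − m_ij m_kl; the cumulant subtracts two further products, which are
added back. -/
theorem covariance_outerProd (hf : ∀ k, MemLp (fun ω => f ω k) 4 P) (i j k l : Fin K) :
    cov[fun ω => outerProd f P ω i j, fun ω => outerProd f P ω k l; P] =
      cumulant4 f P i j k l
        + centralMom f P ![i, k] * centralMom f P ![j, l]
        + centralMom f P ![i, l] * centralMom f P ![j, k] := by
  rw [covariance_eq_sub (memLp_two_outerProd hf i j) (memLp_two_outerProd hf k l)]
  simp only [cumulant4, centralMom, outerProd, Matrix.of_apply, Fin.prod_univ_four,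
    Fin.prod_univ_two, Pi.mul_apply, Matrix.cons_val_zero, Matrix.cons_val_one, Matrix.cons_val]
  simp only [mul_assoc]
  ring

theorem posSemidef_Hmat (hf : ∀ k, MemLp (fun ω => f ω k) 4 P) : (Hmat f P).PosSemidef :=
  posSemidef_covMat fun r => memLp_two_outerProd hf r.1.2 r.1.1

theorem posSemidef_Gmat (hf : ∀ k, MemLp (fun ω => f ω k) 4 P) {A : Matrix (Fin K) (Fin K) ℝ}
    (hA : A.IsSymm) : (Gmat A (Hmat f P)).PosSemidef := by
  rw [Gmat_eq hA, ← Matrix.conjTranspose_eq_transpose_of_trivial]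
  exact (posSemidef_Hmat hf).mul_mul_conjTranspose_same _

end Covariance

/-! ### Algebraic decomposition of the estimation error -/

section Decomposition

variable {n K p : ℕ}

theorem Bhat_add {B : Matrix (Fin p) (Fin K) ℝ} {X : Matrix (Fin K) (Fin n) ℝ}
    (E : Matrix (Fin p) (Fin n) ℝ) (hX : (X * Xᵀ).det ≠ 0) :
    Bhat X (B * X + E) = B + E * Xᵀ * (X * Xᵀ)⁻¹ := by
  rw [Bhat, Matrix.add_mul, Matrix.add_mul, Matrix.mul_assoc B, Matrix.mul_assoc B,
    Matrix.mul_nonsing_inv _ (isUnit_iff_ne_zero.2 hX), Matrix.mul_one]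

/-- The residuals are E times the projection onto the orthogonal complement of the row space of X;
BX is annihilated, and idempotence collapses the cross terms. -/
theorem resid_mul_transpose {B : Matrix (Fin p) (Fin K) ℝ} {X : Matrix (Fin K) (Fin n) ℝ}
    (E : Matrix (Fin p) (Fin n) ℝ) (hX : (X * Xᵀ).det ≠ 0) :
    resid X (B * X + E) * (resid X (B * X + E))ᵀ =
      E * Eᵀ - E * Xᵀ * (X * Xᵀ)⁻¹ * (E * Xᵀ)ᵀ := by
  have hr : resid X (B * X + E) = E - E * Xᵀ * (X * Xᵀ)⁻¹ * X := by
    rw [resid, Bhat_add E hX, Matrix.add_mul]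
    abel
  have hsymm : ((X * Xᵀ)⁻¹)ᵀ = (X * Xᵀ)⁻¹ := by
    rw [Matrix.transpose_nonsing_inv, Matrix.transpose_mul, Matrix.transpose_transpose]
  have hc : (X * Xᵀ)⁻¹ * (X * Xᵀ) = 1 := Matrix.nonsing_inv_mul _ (isUnit_iff_ne_zero.2 hX)
  rw [hr, Matrix.transpose_sub, Matrix.transpose_mul (E * Xᵀ * (X * Xᵀ)⁻¹),
    Matrix.transpose_mul (E * Xᵀ), hsymm, Matrix.transpose_mul E, Matrix.transpose_transpose]
  have h1 : E * Xᵀ * (X * Xᵀ)⁻¹ * X * (Xᵀ * ((X * Xᵀ)⁻¹ * (X * Eᵀ))) =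
      E * Xᵀ * (X * Xᵀ)⁻¹ * (X * Eᵀ) := by
    calc _ = E * Xᵀ * ((X * Xᵀ)⁻¹ * (X * Xᵀ)) * ((X * Xᵀ)⁻¹ * (X * Eᵀ)) := by
          simp only [Matrix.mul_assoc]
      _ = _ := by rw [hc, Matrix.mul_one, Matrix.mul_assoc (E * Xᵀ)]
  rw [Matrix.sub_mul, Matrix.mul_sub, Matrix.mul_sub, h1]
  simp only [Matrix.mul_assoc]
  abel

/-- Substitute B̂ = B + D with D = EX'(XX')⁻¹ and expand. The powers of n and p are distributed so
that every factor converges or stays bounded in probability: WS⁻¹ = p⁻¹√n B'D tends to 0, and the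
term quadratic in D keeps an extra n^(-1/2). -/
theorem smul_congr_SigmaHat_sub {B : Matrix (Fin p) (Fin K) ℝ} {X : Matrix (Fin K) (Fin n) ℝ}
    (E : Matrix (Fin p) (Fin n) ℝ) (hX : (X * Xᵀ).det ≠ 0) (hn : n ≠ 0)
    (C : Matrix (Fin K) (Fin K) ℝ) (T : Matrix (Fin p) (Fin p) ℝ)
    {L S W V : Matrix (Fin K) (Fin K) ℝ} (hL : L = (p : ℝ)⁻¹ • (Bᵀ * B))
    (hS : S = (n : ℝ)⁻¹ • (X * Xᵀ)) (hW : W = ((p : ℝ)⁻¹ * (√(n : ℝ))⁻¹) • (Bᵀ * E * Xᵀ))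
    (hV : V = √(n : ℝ) • (covHat X - C)) :
    √(n : ℝ) • (((p : ℝ) ^ 2)⁻¹ • (Bᵀ * (SigmaHat X (B * X + E) - (B * C * Bᵀ + T)) * B)) =
      L * V * L + W * S⁻¹ * covHat X * L + L * covHat X * (W * S⁻¹)ᵀ
        + (√(n : ℝ))⁻¹ • (W * S⁻¹ * covHat X * (W * S⁻¹)ᵀ)
        + (√(n : ℝ) * ((p : ℝ) ^ 2)⁻¹) • (Bᵀ * (Sigma0Hat X (B * X + E) - T) * B) := by
  have hn0 : (n : ℝ) ≠ 0 := Nat.cast_ne_zero.2 hn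
  have hsq : √(n : ℝ) * √(n : ℝ) = n := Real.mul_self_sqrt (Nat.cast_nonneg n)
  have hs0 : √(n : ℝ) ≠ 0 := fun h => hn0 (by rw [← hsq, h, zero_mul])
  set D := E * Xᵀ * (X * Xᵀ)⁻¹ with hD
  have hWS : W * S⁻¹ = ((p : ℝ)⁻¹ * √(n : ℝ)) • (Bᵀ * D) := by
    have hSi : S⁻¹ = (n : ℝ) • (X * Xᵀ)⁻¹ := by
      rw [hS]
      refine Matrix.inv_eq_left_inv ?_
      rw [Matrix.smul_mul, Matrix.mul_smul, smul_smul, mul_inv_cancel₀ hn0, one_smul,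
        Matrix.nonsing_inv_mul _ (isUnit_iff_ne_zero.2 hX)]
    rw [hW, hSi, Matrix.smul_mul, Matrix.mul_smul, smul_smul, hD]
    congr 1
    · rw [mul_assoc, (inv_mul_eq_iff_eq_mul₀ hs0).2 hsq.symm]
    · simp only [Matrix.mul_assoc]
  have hexp : Bᵀ * (SigmaHat X (B * X + E) - (B * C * Bᵀ + T)) * B =
      Bᵀ * B * (covHat X - C) * (Bᵀ * B) + Bᵀ * D * covHat X * (Bᵀ * B)
        + Bᵀ * B * covHat X * (Bᵀ * D)ᵀ + Bᵀ * D * covHat X * (Bᵀ * D)ᵀ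
        + Bᵀ * (Sigma0Hat X (B * X + E) - T) * B := by
    rw [SigmaHat, Bhat_add E hX, ← hD]
    simp only [Matrix.transpose_add, Matrix.transpose_mul, Matrix.transpose_transpose,
      Matrix.add_mul, Matrix.mul_add, Matrix.sub_mul, Matrix.mul_sub, Matrix.mul_assoc]
    abel
  rw [hexp, hWS, hL, hV]
  simp only [Matrix.transpose_smul, Matrix.smul_mul, Matrix.mul_smul, smul_smul, smul_add]
  have e2 : (√(n : ℝ))⁻¹ * ((p : ℝ)⁻¹ * √(n : ℝ) * ((p : ℝ)⁻¹ * √(n : ℝ))) =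
      √(n : ℝ) * ((p : ℝ) ^ 2)⁻¹ := by
    rw [inv_mul_eq_iff_eq_mul₀ hs0]
    ring
  congr 1
  · congr 1
    · congr 1
      · congr 1
        · congr 1
          ring
        · congr 1
          ring
      · congr 1
        ring
    · rw [← e2]

theorem mul_mul_transpose_diag {α β : Type*} [Fintype β] (M : Matrix α β ℝ) (N : Matrix β β ℝ)
    (a : α) : (M * N * Mᵀ) a a = ∑ m, ∑ m', N m m' * (M a m * M a m') := by
  simp only [Matrix.mul_apply, Matrix.transpose_apply, Finset.sum_mul]
  rw [Finset.sum_comm]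
  exact Finset.sum_congr rfl fun m _ => Finset.sum_congr rfl fun m' _ => by ring

/-- As T is diagonal, so is Σ̂₀ − T. The first sum is the fluctuation of the squared errors; the
second is the cost of estimating B, and carries an extra n^(-1/2). -/
theorem smul_congr_diag_apply {B : Matrix (Fin p) (Fin K) ℝ} {X : Matrix (Fin K) (Fin n) ℝ}
    (E : Matrix (Fin p) (Fin n) ℝ) (hX : (X * Xᵀ).det ≠ 0) (hn : n ≠ 0)
    {T : Matrix (Fin p) (Fin p) ℝ} (hT : T.IsDiag)
    {S : Matrix (Fin K) (Fin K) ℝ} (hS : S = (n : ℝ)⁻¹ • (X * Xᵀ)) (k l : Fin K) :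
    ((√(n : ℝ) * ((p : ℝ) ^ 2)⁻¹) • (Bᵀ * (Sigma0Hat X (B * X + E) - T) * B)) k l =
      ((p : ℝ) ^ 2)⁻¹ * ∑ a, B a k * B a l * ((√(n : ℝ))⁻¹ * ∑ i, (E a i ^ 2 - T a a))
      - (√(n : ℝ))⁻¹ * ∑ m, ∑ m', S⁻¹ m m' * (((p : ℝ) ^ 2)⁻¹ * ∑ a, B a k * B a l *
          (((√(n : ℝ))⁻¹ * ∑ i, E a i * X m i) * ((√(n : ℝ))⁻¹ * ∑ i, E a i * X m' i))) := by
  have hn0 : (n : ℝ) ≠ 0 := Nat.cast_ne_zero.2 hn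
  have hsq : √(n : ℝ) * √(n : ℝ) = n := Real.mul_self_sqrt (Nat.cast_nonneg n)
  have hs0 : √(n : ℝ) ≠ 0 := fun h => hn0 (by rw [← hsq, h, zero_mul])
  have hni : (n : ℝ)⁻¹ = (√(n : ℝ))⁻¹ * (√(n : ℝ))⁻¹ := by rw [← mul_inv, hsq]
  have hSi : (X * Xᵀ)⁻¹ = (n : ℝ)⁻¹ • S⁻¹ := by
    refine Matrix.inv_eq_left_inv ?_
    rw [hS, Matrix.smul_mul, ← Matrix.mul_smul, ← hS]
    refine Matrix.nonsing_inv_mul _ (isUnit_iff_ne_zero.2 ?_)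
    rw [hS, Matrix.det_smul]
    exact mul_ne_zero (pow_ne_zero _ (inv_ne_zero hn0)) hX
  have hdg : Sigma0Hat X (B * X + E) - T = Matrix.diagonal fun a =>
      (n : ℝ)⁻¹ * (∑ i, E a i ^ 2 - (n : ℝ)⁻¹ * ∑ m, ∑ m', S⁻¹ m m' *
        ((∑ i, E a i * X m i) * ∑ i, E a i * X m' i)) - T a a := by
    conv_lhs => rw [← hT.diagonal_diag]
    rw [Sigma0Hat, resid_mul_transpose E hX, Matrix.diagonal_sub, hSi]
    congr 1
    funext a
    simp only [Matrix.diag_apply, Matrix.smul_apply, Matrix.sub_apply, smul_eq_mul,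
      Matrix.mul_smul, Matrix.smul_mul]
    congr 3
    · simp only [Matrix.mul_apply, Matrix.transpose_apply, sq]
    · rw [mul_mul_transpose_diag]
      simp only [Matrix.mul_apply, Matrix.transpose_apply]
  have hentry : ∀ v : Fin p → ℝ, (Bᵀ * Matrix.diagonal v * B) k l = ∑ a, B a k * B a l * v a := by
    intro v
    rw [Matrix.mul_apply]
    simp only [Matrix.mul_diagonal, Matrix.transpose_apply]
    exact Finset.sum_congr rfl fun a _ => by ring
  rw [Matrix.smul_apply, smul_eq_mul, hdg, hentry]
  have hswap : ∑ m, ∑ m', S⁻¹ m m' * (((p : ℝ) ^ 2)⁻¹ * ∑ a, B a k * B a l *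
      (((√(n : ℝ))⁻¹ * ∑ i, E a i * X m i) * ((√(n : ℝ))⁻¹ * ∑ i, E a i * X m' i)))
      = ((p : ℝ) ^ 2)⁻¹ * ∑ a, B a k * B a l * ((n : ℝ)⁻¹ * ∑ m, ∑ m', S⁻¹ m m' *
        ((∑ i, E a i * X m i) * ∑ i, E a i * X m' i)) := by
    simp only [Finset.mul_sum (Finset.univ : Finset (Fin p))]
    conv_rhs => simp only [Finset.mul_sum (Finset.univ : Finset (Fin K))]
    conv_lhs => enter [2, m]; rw [Finset.sum_comm]
    rw [Finset.sum_comm]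
    refine Finset.sum_congr rfl fun a _ => Finset.sum_congr rfl fun m _ =>
      Finset.sum_congr rfl fun m' _ => ?_
    rw [hni]
    ring
  rw [hswap, mul_assoc, mul_left_comm (√(n : ℝ))⁻¹, ← mul_sub, mul_left_comm]
  congr 1
  rw [Finset.mul_sum, Finset.mul_sum, ← Finset.sum_sub_distrib]
  refine Finset.sum_congr rfl fun a _ => ?_
  rw [Finset.sum_sub_distrib, Finset.sum_const, Finset.card_univ, Fintype.card_fin, nsmul_eq_mul]
  generalize ∑ m, ∑ m', S⁻¹ m m' * ((∑ i, E a i * X m i) * ∑ i, E a i * X m' i) = q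
  generalize ∑ i, E a i ^ 2 = e
  have h1 : (√(n : ℝ))⁻¹ = √(n : ℝ) * (n : ℝ)⁻¹ := by
    rw [hni, ← mul_assoc, mul_inv_cancel₀ hs0, one_mul]
  have h2 : (n : ℝ)⁻¹ * n = 1 := inv_mul_cancel₀ hn0
  rw [h1]
  linear_combination (B a k * B a l * √(n : ℝ) * T a a) * h2

/-- The sample covariance is invariant under translation of the data, so it may be centered at any
μ; the true mean of the factors is the useful choice. -/
theorem covHat_apply (X : Matrix (Fin K) (Fin n) ℝ) (hn : 2 ≤ n) (μ : Fin K → ℝ) (k l : Fin K) :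
    covHat X k l = ((n : ℝ) - 1)⁻¹ * (∑ i, (X k i - μ k) * (X l i - μ l)
      - (n : ℝ)⁻¹ * ((∑ i, (X k i - μ k)) * ∑ i, (X l i - μ l))) := by
  have hn0 : (n : ℝ) ≠ 0 := Nat.cast_ne_zero.2 (by omega)
  have h0 : covHat X k l = ((n : ℝ) - 1)⁻¹ * (∑ i, X k i * X l i
      - (n : ℝ)⁻¹ * ((∑ i, X k i) * ∑ i, X l i)) := by
    simp only [covHat, Matrix.sub_apply, Matrix.smul_apply, smul_eq_mul, Matrix.mul_apply,
      Matrix.transpose_apply, Matrix.of_apply, mul_one, ← Finset.mul_sum, mul_inv]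
    ring
  rw [h0]
  congr 1
  have h1 : ∀ i, (X k i - μ k) * (X l i - μ l) =
      X k i * X l i - μ l * X k i - μ k * X l i + μ k * μ l := fun i => by ring
  simp only [h1, Finset.sum_add_distrib, Finset.sum_sub_distrib, ← Finset.mul_sum,
    Finset.sum_const, Finset.card_univ, Fintype.card_fin, nsmul_eq_mul]
  field_simp
  ring

end Decomposition
-- Population moments from the conditional moments of the errors
section Population

variable {Ω₀ : Type*} [mΩ : MeasurableSpace Ω₀] {P₀ : Measure Ω₀} [IsProbabilityMeasure P₀]
  {K p : ℕ} {f : Ω₀ → Fin K → ℝ} {ε : Ω₀ → Fin p → ℝ} {T : Matrix (Fin p) (Fin p) ℝ}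

/-- Condition on m and pull g out. This replaces independence of errors and factors, which is not
assumed. -/
theorem integral_mul_of_condExp_const {m : MeasurableSpace Ω₀} (hm : m ≤ mΩ) {U g : Ω₀ → ℝ} {c : ℝ}
    (hg : StronglyMeasurable[m] g) (hU : Integrable U P₀)
    (hUg : Integrable (fun ω => U ω * g ω) P₀) (hc : P₀[U | m] =ᵐ[P₀] fun _ => c) :
    ∫ ω, U ω * g ω ∂P₀ = c * ∫ ω, g ω ∂P₀ := by
  have h := condExp_mul_of_stronglyMeasurable_right hg hUg hU
  rw [← integral_condExp hm, ← integral_const_mul]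
  refine integral_congr_ae (h.trans ?_)
  filter_upwards [hc] with ω hω
  simp [hω]

omit [IsProbabilityMeasure P₀] in
-- The conditional means vanish almost surely, so the conditional covariance is the conditional
-- second moment.
theorem condExp_mul_errors
    (hmean : ∀ a, P₀[fun ω => ε ω a | MeasurableSpace.comap f inferInstance] =ᵐ[P₀] 0)
    (hcov : ∀ a b, condCov (fun ω => ε ω a) (fun ω => ε ω b) f P₀ =ᵐ[P₀] fun _ => T a b)
    (a b : Fin p) :
    P₀[fun ω => ε ω a * ε ω b | MeasurableSpace.comap f inferInstance] =ᵐ[P₀] fun _ => T a b := by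
  refine EventuallyEq.trans (condExp_congr_ae ?_) (hcov a b)
  filter_upwards [hmean a, hmean b] with ω ha hb
  simp [ha, hb]

omit mΩ in
theorem stronglyMeasurable_comap_apply (f : Ω₀ → Fin K → ℝ) (k : Fin K) :
    StronglyMeasurable[MeasurableSpace.comap f inferInstance] fun ω => f ω k :=
  ((measurable_pi_apply k).comp (comap_measurable f)).stronglyMeasurable

theorem memLp_two_of_four {u : Ω₀ → ℝ} (hu : MemLp u 4 P₀) : MemLp u 2 P₀ :=
  hu.mono_exponent (by norm_num)

theorem integral_error (hf : Measurable f)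
    (hmean : ∀ a, P₀[fun ω => ε ω a | MeasurableSpace.comap f inferInstance] =ᵐ[P₀] 0)
    (a : Fin p) : ∫ ω, ε ω a ∂P₀ = 0 := by
  rw [← integral_condExp hf.comap_le, integral_congr_ae (hmean a)]
  simp

theorem integral_error_mul (hf : Measurable f) (hc : ∀ k, MemLp (fun ω => f ω k) 4 P₀)
    (hd : ∀ a, MemLp (fun ω => ε ω a) 4 P₀)
    (hmean : ∀ a, P₀[fun ω => ε ω a | MeasurableSpace.comap f inferInstance] =ᵐ[P₀] 0)
    (a : Fin p) (k : Fin K) : ∫ ω, ε ω a * f ω k ∂P₀ = 0 := by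
  rw [integral_mul_of_condExp_const (c := 0) hf.comap_le (stronglyMeasurable_comap_apply f k)
    ((hd a).integrable (by norm_num)) ((memLp_two_mul (hd a) (hc k)).integrable one_le_two)
    (hmean a), zero_mul]

theorem integral_errors (hf : Measurable f)
    (hmean : ∀ a, P₀[fun ω => ε ω a | MeasurableSpace.comap f inferInstance] =ᵐ[P₀] 0)
    (hcov : ∀ a b, condCov (fun ω => ε ω a) (fun ω => ε ω b) f P₀ =ᵐ[P₀] fun _ => T a b)
    (a b : Fin p) : ∫ ω, ε ω a * ε ω b ∂P₀ = T a b := by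
  rw [← integral_condExp hf.comap_le, integral_congr_ae (condExp_mul_errors hmean hcov a b)]
  simp

theorem integral_errors_mul_sq (hf : Measurable f) (hc : ∀ k, MemLp (fun ω => f ω k) 4 P₀)
    (hd : ∀ a, MemLp (fun ω => ε ω a) 4 P₀)
    (hmean : ∀ a, P₀[fun ω => ε ω a | MeasurableSpace.comap f inferInstance] =ᵐ[P₀] 0)
    (hcov : ∀ a b, condCov (fun ω => ε ω a) (fun ω => ε ω b) f P₀ =ᵐ[P₀] fun _ => T a b)
    (a b : Fin p) (k : Fin K) :
    ∫ ω, (ε ω a * ε ω b) * f ω k ^ 2 ∂P₀ = T a b * ∫ ω, f ω k ^ 2 ∂P₀ := by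
  refine integral_mul_of_condExp_const hf.comap_le ((stronglyMeasurable_comap_apply f k).pow 2)
    ((memLp_two_mul (hd a) (hd b)).integrable one_le_two) ?_ (condExp_mul_errors hmean hcov a b)
  simp only [sq]
  exact (memLp_two_mul (hd a) (hd b)).integrable_mul (memLp_two_mul (hc k) (hc k))

omit [IsProbabilityMeasure P₀] in
theorem memLp_two_linComb_mul (hc : ∀ k, MemLp (fun ω => f ω k) 4 P₀)
    (hd : ∀ a, MemLp (fun ω => ε ω a) 4 P₀) (w : Fin p → ℝ) (k : Fin K) :
    MemLp (fun ω => (∑ a, w a * ε ω a) * f ω k) 2 P₀ :=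
  memLp_two_mul (memLp_finsetSum _ fun a _ => (hd a).const_mul (w a)) (hc k)

theorem integral_linComb_mul (hf : Measurable f) (hc : ∀ k, MemLp (fun ω => f ω k) 4 P₀)
    (hd : ∀ a, MemLp (fun ω => ε ω a) 4 P₀)
    (hmean : ∀ a, P₀[fun ω => ε ω a | MeasurableSpace.comap f inferInstance] =ᵐ[P₀] 0)
    (w : Fin p → ℝ) (k : Fin K) : ∫ ω, (∑ a, w a * ε ω a) * f ω k ∂P₀ = 0 := by
  simp only [Finset.sum_mul, mul_assoc]
  rw [integral_finsetSum _ fun a _ =>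
    ((memLp_two_mul (hd a) (hc k)).integrable one_le_two).const_mul (w a)]
  simp [integral_const_mul, integral_error_mul hf hc hd hmean]

/-- Diagonality of T removes the cross terms. A sum of w_a² over one index is left instead of a
double sum; this is the source of the gain 1/p. -/
theorem integral_linComb_mul_sq (hf : Measurable f) (hc : ∀ k, MemLp (fun ω => f ω k) 4 P₀)
    (hd : ∀ a, MemLp (fun ω => ε ω a) 4 P₀)
    (hmean : ∀ a, P₀[fun ω => ε ω a | MeasurableSpace.comap f inferInstance] =ᵐ[P₀] 0)
    (hcov : ∀ a b, condCov (fun ω => ε ω a) (fun ω => ε ω b) f P₀ =ᵐ[P₀] fun _ => T a b)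
    (hT : T.IsDiag) (w : Fin p → ℝ) (k : Fin K) :
    ∫ ω, ((∑ a, w a * ε ω a) * f ω k) ^ 2 ∂P₀ =
      (∑ a, w a ^ 2 * T a a) * ∫ ω, f ω k ^ 2 ∂P₀ := by
  have hpt : ∀ ω, ((∑ a, w a * ε ω a) * f ω k) ^ 2 =
      ∑ a, ∑ b, w a * w b * ((ε ω a * ε ω b) * f ω k ^ 2) := fun ω => by
    rw [mul_pow, sq (∑ a, _), Finset.sum_mul_sum, Finset.sum_mul]
    refine Finset.sum_congr rfl fun a _ => ?_
    rw [Finset.sum_mul]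
    exact Finset.sum_congr rfl fun b _ => by ring
  have hint : ∀ a b, Integrable (fun ω => w a * w b * ((ε ω a * ε ω b) * f ω k ^ 2)) P₀ :=
    fun a b => by
      simp only [sq]
      exact ((memLp_two_mul (hd a) (hd b)).integrable_mul
        (memLp_two_mul (hc k) (hc k))).const_mul _
  simp only [hpt]
  rw [integral_finsetSum _ fun a _ => integrable_finsetSum _ fun b _ => hint a b, Finset.sum_mul]
  refine Finset.sum_congr rfl fun a _ => ?_
  rw [integral_finsetSum _ fun b _ => hint a b, Finset.sum_eq_single a]
  · rw [integral_const_mul, integral_errors_mul_sq hf hc hd hmean hcov]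
    ring
  · intro b _ hba
    rw [integral_const_mul, integral_errors_mul_sq hf hc hd hmean hcov, hT hba.symm]
    simp
  · simp

theorem covMat_obs (hf : Measurable f) (hc : ∀ k, MemLp (fun ω => f ω k) 4 P₀)
    (hd : ∀ a, MemLp (fun ω => ε ω a) 4 P₀)
    (hmean : ∀ a, P₀[fun ω => ε ω a | MeasurableSpace.comap f inferInstance] =ᵐ[P₀] 0)
    (hcov : ∀ a b, condCov (fun ω => ε ω a) (fun ω => ε ω b) f P₀ =ᵐ[P₀] fun _ => T a b)
    (B : Matrix (Fin p) (Fin K) ℝ) :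
    covMat (obs B f ε) P₀ = B * covMat f P₀ * Bᵀ + T := by
  have hf2 : ∀ k, MemLp (fun ω => f ω k) 2 P₀ := fun k => memLp_two_of_four (hc k)
  have he2 : ∀ a, MemLp (fun ω => ε ω a) 2 P₀ := fun a => memLp_two_of_four (hd a)
  have hBf : ∀ a k, MemLp (fun ω => B a k * f ω k) 2 P₀ := fun a k => (hf2 k).const_mul _
  have hcomm : ∀ a, MemLp (fun ω => ∑ k, B a k * f ω k) 2 P₀ :=
    fun a => memLp_finsetSum _ fun k _ => hBf a k
  have hce : ∀ a b, cov[fun ω => ε ω a, fun ω => ε ω b; P₀] = T a b := fun a b => by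
    rw [covariance_eq_sub (he2 a) (he2 b), integral_error hf hmean, zero_mul, sub_zero]
    exact integral_errors hf hmean hcov a b
  have hcef : ∀ a k, cov[fun ω => ε ω a, fun ω => f ω k; P₀] = 0 := fun a k => by
    rw [covariance_eq_sub (he2 a) (hf2 k), integral_error hf hmean, zero_mul, sub_zero]
    exact integral_error_mul hf hc hd hmean a k
  have hcross : ∀ a b, cov[fun ω => ε ω a, fun ω => ∑ k, B b k * f ω k; P₀] = 0 := fun a b => by
    rw [covariance_fun_sum_right (fun k => hBf b k) (he2 a)]
    simp [covariance_const_mul_right, hcef]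
  have hfun : ∀ a, (fun ω => obs B f ε ω a) =
      (fun ω => ∑ k, B a k * f ω k) + fun ω => ε ω a := fun a => by
    funext ω
    simp [obs, Matrix.mulVec, dotProduct]
  ext a b
  rw [covMat, Matrix.of_apply, hfun, hfun, covariance_add_left (hcomm a) (he2 a)
    ((hcomm b).add (he2 b)), covariance_add_right (hcomm a) (hcomm b) (he2 b),
    covariance_add_right (he2 a) (hcomm b) (he2 b), hcross, hce,
    covariance_comm _ fun ω => ε ω b, hcross, covariance_fun_sum_fun_sum (hBf a) (hBf b)]
  simp only [covariance_const_mul_left, covariance_const_mul_right, Matrix.add_apply,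
    Matrix.mul_apply, covMat, Matrix.of_apply, Matrix.transpose_apply, Finset.sum_mul, add_zero,
    zero_add]
  rw [Finset.sum_comm]
  congr 1
  exact Finset.sum_congr rfl fun _ _ => Finset.sum_congr rfl fun _ _ => by ring

/-- The second moment matrix of a random vector with nonsingular covariance is nonsingular. -/
theorem det_secondMoment_ne_zero (hf2 : ∀ k, MemLp (fun ω => f ω k) 2 P₀)
    (hpd : (covMat f P₀).PosDef) :
    (Matrix.of fun k l => ∫ ω, f ω k * f ω l ∂P₀ : Matrix (Fin K) (Fin K) ℝ).det ≠ 0 := by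
  have h : (Matrix.of fun k l => ∫ ω, f ω k * f ω l ∂P₀ : Matrix (Fin K) (Fin K) ℝ) =
      covMat f P₀ + Matrix.vecMulVec (fun k => ∫ ω, f ω k ∂P₀)
        (star fun k => ∫ ω, f ω k ∂P₀) := by
    ext k l
    simp only [covMat, Matrix.add_apply, Matrix.of_apply, covariance_eq_sub (hf2 k) (hf2 l),
      Matrix.vecMulVec_apply, star_trivial]
    exact (sub_add_cancel _ _).symm
  rw [h]
  exact (hpd.add_posSemidef (Matrix.posSemidef_vecMulVec_self_star _)).det_pos.ne'

end Population

/-! ### Triangular arrays: the sample moments of the factors -/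

section Arrays

variable {Ω₀ : Type*} [MeasurableSpace Ω₀] {P₀ : Measure Ω₀} [IsProbabilityMeasure P₀]
  {Ω : ℕ → Type*} [∀ n, MeasurableSpace (Ω n)] {P : ∀ n, Measure (Ω n)}
  [∀ n, IsProbabilityMeasure (P n)]

section

variable {𝓧 : ℕ → Type*} [∀ n, MeasurableSpace (𝓧 n)] {z : ∀ n, Fin n → Ω n → 𝓧 n}
  {ζ : ∀ n, Ω₀ → 𝓧 n} {φ : ∀ n, 𝓧 n → ℝ}

theorem boundedInProb_normSum (hind : ∀ n, iIndepFun (z n) (P n))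
    (hid : ∀ n i, IdentDistrib (z n i) (ζ n) (P n) P₀) (hφ : ∀ n, Measurable (φ n))
    (h2 : ∀ n, MemLp (fun ω => φ n (ζ n ω)) 2 P₀) (h0 : ∀ n, ∫ ω, φ n (ζ n ω) ∂P₀ = 0) {c : ℝ}
    (hc : ∀ n, ∫ ω, φ n (ζ n ω) ^ 2 ∂P₀ ≤ c) :
    BoundedInProb P fun n ω => normSum (φ n) (z n) ω :=
  boundedInProb_of_integral_sq (fun n => memLp_normSum (hid n) (hφ n) (h2 n)) fun n =>
    (integral_normSum_sq_le (hind n) (hid n) (hφ n) (h2 n) (h0 n)).trans (hc n)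

theorem tendstoZeroInProb_normSum (hind : ∀ n, iIndepFun (z n) (P n))
    (hid : ∀ n i, IdentDistrib (z n i) (ζ n) (P n) P₀) (hφ : ∀ n, Measurable (φ n))
    (h2 : ∀ n, MemLp (fun ω => φ n (ζ n ω)) 2 P₀) (h0 : ∀ n, ∫ ω, φ n (ζ n ω) ∂P₀ = 0) {b : ℕ → ℝ}
    (hle : ∀ n, ∫ ω, φ n (ζ n ω) ^ 2 ∂P₀ ≤ b n) (hb : Tendsto b atTop (𝓝 0)) :
    TendstoZeroInProb P fun n ω => normSum (φ n) (z n) ω :=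
  tendstoZeroInProb_of_integral_sq (fun n => memLp_normSum (hid n) (hφ n) (h2 n))
    (.of_forall fun n =>
      (integral_normSum_sq_le (hind n) (hid n) (hφ n) (h2 n) (h0 n)).trans (hle n)) hb

end

theorem tendsto_inv_sqrt_natCast : Tendsto (fun n : ℕ => (√(n : ℝ))⁻¹) atTop (𝓝 0) :=
  tendsto_inv_atTop_zero.comp (Real.tendsto_sqrt_atTop.comp tendsto_natCast_atTop_atTop)

theorem tendsto_inv_natCast_sub_one : Tendsto (fun n : ℕ => ((n : ℝ) - 1)⁻¹) atTop (𝓝 0) :=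
  tendsto_inv_atTop_zero.comp
    (tendsto_atTop_add_const_right _ (-1 : ℝ) tendsto_natCast_atTop_atTop)

theorem tendsto_sqrt_mul_inv_natCast_sub_one :
    Tendsto (fun n : ℕ => √(n : ℝ) * ((n : ℝ) - 1)⁻¹) atTop (𝓝 0) := by
  -- For n ≥ 2 one has n ≤ 2(n − 1), that is √n / (n − 1) ≤ 2 / √n.
  have h2 : Tendsto (fun n : ℕ => 2 * (√(n : ℝ))⁻¹) atTop (𝓝 0) := by
    simpa using tendsto_inv_sqrt_natCast.const_mul 2
  refine squeeze_zero' ?_ ?_ h2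
  · filter_upwards [eventually_ge_atTop 2] with n hn
    have : (2 : ℝ) ≤ n := by exact_mod_cast hn
    exact mul_nonneg (Real.sqrt_nonneg _) (inv_nonneg.2 (by linarith))
  · filter_upwards [eventually_ge_atTop 2] with n hn
    have hn2 : (2 : ℝ) ≤ n := by exact_mod_cast hn
    have hs : 0 < √(n : ℝ) := Real.sqrt_pos.2 (by linarith)
    have hsq : √(n : ℝ) * √(n : ℝ) = n := Real.mul_self_sqrt (by linarith)
    rw [← div_eq_mul_inv, ← div_eq_mul_inv, div_le_div_iff₀ (by linarith) hs, hsq]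
    linarith

section Factors

variable {K : ℕ} {f : Ω₀ → Fin K → ℝ} {fs : ∀ n, Fin n → Ω n → Fin K → ℝ}

/-- The deviation is n^(-1/2) times a normalized sum, which is bounded in probability because the
factors have fourth moments. -/
theorem matTendstoZeroInProb_secondMoment (hind : ∀ n, iIndepFun (fs n) (P n))
    (hid : ∀ n i, IdentDistrib (fs n i) f (P n) P₀) (hc : ∀ k, MemLp (fun ω => f ω k) 4 P₀) :
    MatTendstoZeroInProb P fun n ω =>
      (n : ℝ)⁻¹ • ((dataMat fun i => fs n i ω) * (dataMat fun i => fs n i ω)ᵀ) -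
        (Matrix.of fun k l => ∫ ω, f ω k * f ω l ∂P₀) := by
  intro k l
  set m := ∫ ω, f ω k * f ω l ∂P₀ with hm
  have hL2 : MemLp (fun ω => f ω k * f ω l) 2 P₀ := memLp_two_mul (hc k) (hc l)
  have hb := boundedInProb_normSum (𝓧 := fun _ => Fin K → ℝ) (ζ := fun _ => f)
    (φ := fun _ x => x k * x l - m) hind hid (fun _ => by fun_prop)
    (fun _ => hL2.sub (memLp_const m))
    (fun _ => by
      rw [integral_sub (hL2.integrable one_le_two) (integrable_const _)]
      simp [hm])
    (fun _ => le_rfl)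
  refine ((tendstoZeroInProb_of_tendsto tendsto_inv_sqrt_natCast).mul_bounded hb).mono ?_
  filter_upwards [eventually_ge_atTop 1] with n hn ω
  have hn0 : (n : ℝ) ≠ 0 := by positivity
  have hni : (n : ℝ)⁻¹ = (√(n : ℝ))⁻¹ * (√(n : ℝ))⁻¹ := by
    rw [← mul_inv, Real.mul_self_sqrt (Nat.cast_nonneg n)]
  refine le_of_eq (congrArg _ ?_)
  simp only [normSum, Finset.sum_sub_distrib, Finset.sum_const, Finset.card_univ,
    Fintype.card_fin, nsmul_eq_mul, Matrix.sub_apply, Matrix.smul_apply, Matrix.mul_apply,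
    Matrix.transpose_apply, dataMat, Matrix.of_apply, smul_eq_mul]
  rw [← mul_assoc, ← hni, mul_sub, inv_mul_cancel_left₀ hn0]

/-- The normalized sum of the centered outer products of the factors. -/
noncomputable def normOuterSum (f : Ω₀ → Fin K → ℝ) (P₀ : Measure Ω₀) {n : ℕ} {Ω' : Type*}
    (x : Fin n → Ω' → Fin K → ℝ) (ω : Ω') : Matrix (Fin K) (Fin K) ℝ :=
  Matrix.of fun k l => normSum (fun x => (x k - ∫ ω', f ω' k ∂P₀) * (x l - ∫ ω', f ω' l ∂P₀)
    - covMat f P₀ k l) x ω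

theorem matBoundedInProb_normOuterSum (hind : ∀ n, iIndepFun (fs n) (P n))
    (hid : ∀ n i, IdentDistrib (fs n i) f (P n) P₀) (hc : ∀ k, MemLp (fun ω => f ω k) 4 P₀) :
    MatBoundedInProb P fun n ω => normOuterSum f P₀ (fs n) ω := by
  intro k l
  have hL2 : MemLp (fun ω => (f ω k - ∫ ω', f ω' k ∂P₀) * (f ω l - ∫ ω', f ω' l ∂P₀)) 2 P₀ :=
    memLp_two_outerProd hc k l
  exact boundedInProb_normSum (𝓧 := fun _ => Fin K → ℝ) (ζ := fun _ => f)
    (φ := fun _ x => (x k - ∫ ω', f ω' k ∂P₀) * (x l - ∫ ω', f ω' l ∂P₀) - covMat f P₀ k l)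
    hind hid (fun _ => by fun_prop) (fun _ => hL2.sub (memLp_const _))
    (fun _ => by
      rw [integral_sub (hL2.integrable one_le_two) (integrable_const _)]
      simp [covMat, covariance])
    (fun _ => le_rfl)

/-- With h_j the normalized sum of the centered j-th factor, the difference is exactly N/(n − 1) +
(√n/(n − 1))(C − hh'): bounded quantities with vanishing coefficients. -/
theorem matTendstoZeroInProb_covHat_sub (hind : ∀ n, iIndepFun (fs n) (P n))
    (hid : ∀ n i, IdentDistrib (fs n i) f (P n) P₀) (hc : ∀ k, MemLp (fun ω => f ω k) 4 P₀) :
    MatTendstoZeroInProb P fun n ω =>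
      √(n : ℝ) • (covHat (dataMat fun i => fs n i ω) - covMat f P₀) -
        normOuterSum f P₀ (fs n) ω := by
  intro k l
  have hN := matBoundedInProb_normOuterSum hind hid hc k l
  have hh : ∀ j, BoundedInProb P fun n ω =>
      normSum (fun x => x j - ∫ ω', f ω' j ∂P₀) (fs n) ω := fun j => by
    have hL2 := memLp_two_of_four (hc j)
    exact boundedInProb_normSum (𝓧 := fun _ => Fin K → ℝ) (ζ := fun _ => f)
      (φ := fun _ x => x j - ∫ ω', f ω' j ∂P₀)
      hind hid (fun _ => by fun_prop) (fun _ => hL2.sub (memLp_const _))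
      (fun _ => by
        rw [integral_sub (hL2.integrable one_le_two) (integrable_const _)]
        simp)
      (fun _ => le_rfl)
  have h1 := (tendstoZeroInProb_of_tendsto (P := P) tendsto_inv_natCast_sub_one).mul_bounded hN
  have h2 := (tendstoZeroInProb_of_tendsto (P := P)
    tendsto_sqrt_mul_inv_natCast_sub_one).mul_bounded (boundedInProb_const (covMat f P₀ k l))
  have h3 := (tendstoZeroInProb_of_tendsto (P := P)
    tendsto_sqrt_mul_inv_natCast_sub_one).mul_bounded ((hh k).mul (hh l))
  refine ((h1.add h2).sub h3).mono ?_
  filter_upwards [eventually_ge_atTop 2] with n hn ω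
  have hn2 : (2 : ℝ) ≤ n := by exact_mod_cast hn
  have hn0 : (n : ℝ) ≠ 0 := by linarith
  have hn1 : (n : ℝ) - 1 ≠ 0 := by linarith
  have hs0 : √(n : ℝ) ≠ 0 := (Real.sqrt_pos.2 (by linarith)).ne'
  have hni : (n : ℝ)⁻¹ = (√(n : ℝ))⁻¹ * (√(n : ℝ))⁻¹ := by
    rw [← mul_inv, Real.mul_self_sqrt (Nat.cast_nonneg n)]
  refine le_of_eq (congrArg _ ?_)
  rw [Matrix.sub_apply, Matrix.smul_apply, Matrix.sub_apply,
    covHat_apply _ hn fun j => ∫ ω', f ω' j ∂P₀]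
  simp only [normOuterSum, normSum, Finset.sum_sub_distrib, Finset.sum_const, Finset.card_univ,
    Fintype.card_fin, nsmul_eq_mul, Matrix.of_apply, smul_eq_mul, dataMat]
  generalize ∑ i, (fs n i ω k - ∫ ω', f ω' k ∂P₀) * (fs n i ω l - ∫ ω', f ω' l ∂P₀) = a
  generalize (∑ i, fs n i ω k - n * ∫ ω', f ω' k ∂P₀) = b
  generalize (∑ i, fs n i ω l - n * ∫ ω', f ω' l ∂P₀) = c
  generalize covMat f P₀ k l = v
  rw [hni]
  have hsq : √(n : ℝ) ^ 2 = n := Real.sq_sqrt (Nat.cast_nonneg n)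
  generalize √(n : ℝ) = s at *
  rw [← hsq] at hn1 ⊢
  field_simp
  ring

/-- By `vech_mul_mul`, vech(ANA) is a normalized sum of i.i.d. vectors `congrMat A` · vech(Uᵢ − C),
whose law is the same for all n and whose covariance is G. -/
theorem tendstoInDistribution_congr_normOuterSum (hind : ∀ n, iIndepFun (fs n) (P n))
    (hid : ∀ n i, IdentDistrib (fs n i) f (P n) P₀) (hc : ∀ k, MemLp (fun ω => f ω k) 4 P₀)
    {A : Matrix (Fin K) (Fin K) ℝ} (hA : A.IsSymm) :
    TendstoInDistribution
      (fun (n : ℕ) ω => WithLp.toLp 2 (vech (A * normOuterSum f P₀ (fs n) ω * A))) atTop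
      (id : EuclideanSpace ℝ (VechIndex K) → EuclideanSpace ℝ (VechIndex K)) P
      (multivariateGaussian 0 (Gmat A (Hmat f P₀))) := by
  set g : (Fin K → ℝ) → VechIndex K → ℝ := fun x r =>
    (x r.1.2 - ∫ ω', f ω' r.1.2 ∂P₀) * (x r.1.1 - ∫ ω', f ω' r.1.1 ∂P₀)
      - covMat f P₀ r.1.2 r.1.1 with hg
  set φ : (Fin K → ℝ) → EuclideanSpace ℝ (VechIndex K) := fun x =>
    WithLp.toLp 2 (congrMat A *ᵥ g x) with hφ
  have hgm : Measurable g := by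
    rw [measurable_pi_iff]
    intro r
    fun_prop
  have hφm : Measurable φ := by
    have h1 : Measurable fun x => congrMat A *ᵥ g x := by
      rw [measurable_pi_iff]
      intro r
      exact Finset.measurable_sum _ fun s _ => ((measurable_pi_apply s).comp hgm).const_mul _
    exact (WithLp.measurable_toLp 2 _).comp h1
  have hL2 : ∀ r : VechIndex K, MemLp (fun ω => vech (outerProd f P₀ ω) r) 2 P₀ :=
    fun r => memLp_two_outerProd hc r.1.2 r.1.1
  have hinner : ∀ (t : EuclideanSpace ℝ (VechIndex K)) ω, (inner ℝ (φ (f ω)) t : ℝ) =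
      ∑ r, (vech (outerProd f P₀ ω) r - ∫ ω', vech (outerProd f P₀ ω') r ∂P₀) *
        ((congrMat A)ᵀ *ᵥ WithLp.ofLp t) r := fun t ω => by
    have : (inner ℝ (φ (f ω)) t : ℝ) = WithLp.ofLp t ⬝ᵥ (congrMat A *ᵥ g (f ω)) := by
      rw [EuclideanSpace.inner_eq_star_dotProduct]
      simp [hφ]
    rw [this, dotProduct_comm, ← Matrix.vecMul_transpose, ← Matrix.dotProduct_mulVec]
    rfl
  have hint : ∀ (t : EuclideanSpace ℝ (VechIndex K)) r, Integrable (fun ω =>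
      (vech (outerProd f P₀ ω) r - ∫ ω', vech (outerProd f P₀ ω') r ∂P₀) *
        ((congrMat A)ᵀ *ᵥ WithLp.ofLp t) r) P₀ := fun t r =>
    (((hL2 r).sub (memLp_const _)).integrable one_le_two).mul_const _
  have hlin : ∀ t : EuclideanSpace ℝ (VechIndex K),
      MemLp (fun ω => (inner ℝ (φ (f ω)) t : ℝ)) 2 P₀ := fun t => by
    simp only [hinner]
    exact memLp_finsetSum _ fun r _ => ((hL2 r).sub (memLp_const _)).mul_const _
  have hclt := tendstoInDistribution_normSum (φ := φ) hind hid hφm (posSemidef_Gmat hc hA) hlin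
    (fun t => by
      simp only [hinner]
      rw [integral_finsetSum _ fun r _ => hint t r]
      refine Finset.sum_eq_zero fun r _ => ?_
      rw [integral_mul_const, integral_sub ((hL2 r).integrable one_le_two) (integrable_const _)]
      simp)
    (fun t => by
      simp only [hinner]
      rw [integral_dotProduct_centered_sq hL2, Gmat_eq hA, ← Hmat, ← Matrix.mulVec_mulVec,
        ← Matrix.mulVec_mulVec, Matrix.dotProduct_mulVec _ (congrMat A), Matrix.mulVec_transpose])
  convert! hclt using 3 with n ω
  have hNs : (normOuterSum f P₀ (fs n) ω).IsSymm := by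
    ext k l
    have hcm : covMat f P₀ l k = covMat f P₀ k l := covariance_comm _ _
    simp only [normOuterSum, Matrix.transpose_apply, Matrix.of_apply, normSum, hcm]
    congr 1
    exact Finset.sum_congr rfl fun i _ => by rw [mul_comm]
  have hvN : vech (normOuterSum f P₀ (fs n) ω) = (√(n : ℝ))⁻¹ • ∑ i, g (fs n i ω) := by
    funext r
    simp [vech, normOuterSum, normSum, hg]
  rw [vech_mul_mul hA hNs, hvN, Matrix.mulVec_smul, Matrix.mulVec_sum, WithLp.toLp_smul,
    WithLp.toLp_sum]

end Factors

end Arrays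

/-! ### Measurability of the estimator -/

section Measurability

variable {Ω α β γ : Type*} [MeasurableSpace Ω]

theorem measurable_mul_apply [Fintype β] {M : Ω → Matrix α β ℝ} {N : Ω → Matrix β γ ℝ}
    (hM : ∀ i j, Measurable fun ω => M ω i j) (hN : ∀ i j, Measurable fun ω => N ω i j) (i : α)
    (j : γ) : Measurable fun ω => (M ω * N ω) i j := by
  simp only [Matrix.mul_apply]
  exact Finset.measurable_sum _ fun k _ => (hM i k).mul (hN k j)

theorem measurable_det [Fintype α] [DecidableEq α] {M : Ω → Matrix α α ℝ}
    (hM : ∀ i j, Measurable fun ω => M ω i j) : Measurable fun ω => (M ω).det := by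
  simp only [Matrix.det_apply]
  exact Finset.measurable_sum _ fun σ _ =>
    (Finset.measurable_prod _ fun i _ => hM (σ i) i).const_smul _

theorem measurable_inv_apply [Fintype α] [DecidableEq α] {M : Ω → Matrix α α ℝ}
    (hM : ∀ i j, Measurable fun ω => M ω i j) (i j : α) : Measurable fun ω => (M ω)⁻¹ i j := by
  simp only [Matrix.inv_def, Ring.inverse_eq_inv', Matrix.smul_apply, smul_eq_mul,
    Matrix.adjugate_apply]
  refine (measurable_det hM).inv.mul (measurable_det fun a b => ?_)
  simp only [Matrix.updateRow_apply]
  split_ifs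
  · exact measurable_const
  · exact hM a b

theorem measurable_SigmaHat_apply {n K p : ℕ} {X : Ω → Matrix (Fin K) (Fin n) ℝ}
    {Y : Ω → Matrix (Fin p) (Fin n) ℝ} (hX : ∀ i j, Measurable fun ω => X ω i j)
    (hY : ∀ i j, Measurable fun ω => Y ω i j) (a b : Fin p) :
    Measurable fun ω => SigmaHat (X ω) (Y ω) a b := by
  have hXt : ∀ i j, Measurable fun ω => (X ω)ᵀ i j := fun i j => hX j i
  have hB : ∀ i j, Measurable fun ω => Bhat (X ω) (Y ω) i j := fun i j =>
    measurable_mul_apply (measurable_mul_apply hY hXt)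
      (measurable_inv_apply (measurable_mul_apply hX hXt)) i j
  have hC : ∀ i j, Measurable fun ω => covHat (X ω) i j := fun i j =>
    ((measurable_mul_apply hX hXt i j).const_mul _).sub
      ((measurable_mul_apply (measurable_mul_apply hX fun _ _ => measurable_const) hXt i
        j).const_mul _)
  have hR : ∀ i j, Measurable fun ω => resid (X ω) (Y ω) i j := fun i j =>
    (hY i j).sub (measurable_mul_apply hB hX i j)
  have hS : Measurable fun ω => Sigma0Hat (X ω) (Y ω) a b := by
    simp only [Sigma0Hat, Matrix.diagonal_apply]
    split_ifs
    · exact (measurable_mul_apply hR (fun i j => hR j i) a a).const_mul _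
    · exact measurable_const
  exact (measurable_mul_apply (measurable_mul_apply hB hC) (fun i j => hB j i) a b).add hS

end Measurability

/-! ### Negligibility of the error terms as the dimension diverges -/

section Errors

variable {Ω₀ : Type*} [MeasurableSpace Ω₀] {P₀ : Measure Ω₀} [IsProbabilityMeasure P₀]
  {Ω : ℕ → Type*} [∀ n, MeasurableSpace (Ω n)] {P : ∀ n, Measure (Ω n)}
  [∀ n, IsProbabilityMeasure (P n)] {K : ℕ} {p : ℕ → ℕ}
  {f : Ω₀ → Fin K → ℝ} {ε : ∀ n, Ω₀ → Fin (p n) → ℝ}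
  {B : ∀ n, Matrix (Fin (p n)) (Fin K) ℝ} {T : ∀ n, Matrix (Fin (p n)) (Fin (p n)) ℝ}
  {fs : ∀ n, Fin n → Ω n → Fin K → ℝ} {es : ∀ n, Fin n → Ω n → Fin (p n) → ℝ}
  {A : Matrix (Fin K) (Fin K) ℝ}

theorem tendsto_inv_mul_sum_sq
    (hBA : Tendsto (fun n => (p n : ℝ)⁻¹ • ((B n)ᵀ * B n)) atTop (𝓝 A)) (k : Fin K) :
    Tendsto (fun n => (p n : ℝ)⁻¹ * ∑ a, B n a k ^ 2) atTop (𝓝 (A k k)) := by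
  have := tendsto_pi_nhds.1 (tendsto_pi_nhds.1 hBA k) k
  simpa [Matrix.mul_apply, sq] using this

theorem tendsto_inv_dim (hp : Tendsto p atTop atTop) :
    Tendsto (fun n => (p n : ℝ)⁻¹) atTop (𝓝 0) :=
  tendsto_inv_atTop_zero.comp (tendsto_natCast_atTop_atTop.comp hp)

omit [∀ n, IsProbabilityMeasure (P n)] in
/-- Averages against the products of two columns of the loading matrix, scaled by `p⁻²`, vanish. -/
theorem tendstoZeroInProb_loading_average {r : ∀ n, Fin (p n) → Ω n → ℝ} {c : ℝ}
    (hint : ∀ n a, Integrable (r n a) (P n)) (hle : ∀ n a, ∫ ω, |r n a ω| ∂P n ≤ c)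
    (hBA : Tendsto (fun n => (p n : ℝ)⁻¹ • ((B n)ᵀ * B n)) atTop (𝓝 A))
    (hp : Tendsto p atTop atTop) (k l : Fin K) :
    TendstoZeroInProb P fun n ω =>
      ((p n : ℝ) ^ 2)⁻¹ * ∑ a, B n a k * B n a l * r n a ω := by
  -- By |B_ak B_al| ≤ B_ak² + B_al², the weights sum to p⁻¹ times a convergent sequence. Working in
  -- L¹ avoids any assumption on the dependence between coordinates.
  have hb : Tendsto (fun n => (p n : ℝ)⁻¹ * (((p n : ℝ)⁻¹ * ∑ a, B n a k ^ 2 +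
      (p n : ℝ)⁻¹ * ∑ a, B n a l ^ 2) * c)) atTop (𝓝 0) := by
    simpa using (tendsto_inv_dim hp).mul
      (((tendsto_inv_mul_sum_sq hBA k).add (tendsto_inv_mul_sum_sq hBA l)).mul_const c)
  refine tendstoZeroInProb_of_integral_abs
    (fun n => (integrable_finsetSum _ fun a _ => (hint n a).const_mul _).const_mul _)
    (.of_forall fun n => ?_) hb
  have hpt : ∀ ω, |((p n : ℝ) ^ 2)⁻¹ * ∑ a, B n a k * B n a l * r n a ω| ≤
      ((p n : ℝ) ^ 2)⁻¹ * ∑ a, (B n a k ^ 2 + B n a l ^ 2) * |r n a ω| := fun ω => by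
    rw [abs_mul, abs_of_nonneg (show (0 : ℝ) ≤ ((p n : ℝ) ^ 2)⁻¹ by positivity)]
    refine mul_le_mul_of_nonneg_left ((Finset.abs_sum_le_sum_abs _ _).trans
      (Finset.sum_le_sum fun a _ => ?_)) (by positivity)
    rw [abs_mul]
    refine mul_le_mul_of_nonneg_right (abs_le.2 ⟨?_, ?_⟩) (abs_nonneg _)
    · nlinarith [sq_nonneg (B n a k + B n a l), sq_nonneg (B n a k), sq_nonneg (B n a l)]
    · nlinarith [sq_nonneg (B n a k - B n a l), sq_nonneg (B n a k), sq_nonneg (B n a l)]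
  have hi : ∀ a, Integrable (fun ω => (B n a k ^ 2 + B n a l ^ 2) * |r n a ω|) (P n) :=
    fun a => (hint n a).abs.const_mul _
  calc _ ≤ ∫ ω, ((p n : ℝ) ^ 2)⁻¹ * ∑ a, (B n a k ^ 2 + B n a l ^ 2) * |r n a ω| ∂P n :=
        integral_mono
          (((integrable_finsetSum _ fun a _ => (hint n a).const_mul _).const_mul _).abs)
          ((integrable_finsetSum _ fun a _ => hi a).const_mul _) hpt
    _ = ((p n : ℝ) ^ 2)⁻¹ * ∑ a, (B n a k ^ 2 + B n a l ^ 2) * ∫ ω, |r n a ω| ∂P n := by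
        rw [integral_const_mul, integral_finsetSum _ fun a _ => hi a]
        simp only [integral_const_mul]
    _ ≤ ((p n : ℝ) ^ 2)⁻¹ * ∑ a, (B n a k ^ 2 + B n a l ^ 2) * c := by
        gcongr with a
        exact hle n a
    _ = _ := by
        rw [← Finset.sum_mul, Finset.sum_add_distrib, sq, mul_inv]
        ring

theorem integral_abs_le_one_add_sq {Ω' : Type*} [MeasurableSpace Ω'] {μ : Measure Ω'}
    [IsProbabilityMeasure μ] {X : Ω' → ℝ} (hX : MemLp X 2 μ) :
    ∫ ω, |X ω| ∂μ ≤ 1 + ∫ ω, X ω ^ 2 ∂μ := by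
  calc _ ≤ ∫ ω, (1 + X ω ^ 2) ∂μ :=
        integral_mono (hX.integrable one_le_two).abs ((integrable_const _).add hX.integrable_sq)
          fun ω => by
            show |X ω| ≤ 1 + X ω ^ 2
            nlinarith [sq_abs (X ω), sq_nonneg (|X ω| - 1), abs_nonneg (X ω)]
    _ = _ := by
        rw [integral_add (integrable_const _) hX.integrable_sq]
        simp

theorem integral_abs_mul_le {Ω' : Type*} [MeasurableSpace Ω'] {μ : Measure Ω'}
    {X Y : Ω' → ℝ} (hX : MemLp X 2 μ) (hY : MemLp Y 2 μ) :
    ∫ ω, |X ω * Y ω| ∂μ ≤ ∫ ω, X ω ^ 2 ∂μ + ∫ ω, Y ω ^ 2 ∂μ := by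
  rw [← integral_add hX.integrable_sq hY.integrable_sq]
  refine integral_mono (hX.integrable_mul hY).abs (hX.integrable_sq.add hY.integrable_sq)
    fun ω => ?_
  show |X ω * Y ω| ≤ X ω ^ 2 + Y ω ^ 2
  exact abs_le.2 ⟨by nlinarith [sq_nonneg (X ω + Y ω), sq_nonneg (X ω), sq_nonneg (Y ω)],
    by nlinarith [sq_nonneg (X ω - Y ω), sq_nonneg (X ω), sq_nonneg (Y ω)]⟩

theorem tendstoZeroInProb_norm_vech_sub {U V : ∀ n, Ω n → Matrix (Fin K) (Fin K) ℝ}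
    (h : MatTendstoZeroInProb P fun n ω => U n ω - V n ω) :
    TendstoZeroInProb P fun n ω =>
      ‖(WithLp.toLp 2 (vech (U n ω)) - WithLp.toLp 2 (vech (V n ω)) :
        EuclideanSpace ℝ (VechIndex K))‖ := by
  have hcont : ContinuousAt
      (fun w : VechIndex K → ℝ => ‖(WithLp.toLp 2 w : EuclideanSpace ℝ (VechIndex K))‖) 0 :=
    (continuous_norm.comp (PiLp.continuous_toLp 2 _)).continuousAt
  have hr : ∀ r : VechIndex K, TendstoZeroInProb P fun n ω =>
      (vech (U n ω) - vech (V n ω)) r - (0 : VechIndex K → ℝ) r := fun r => by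
    simpa [vech] using h r.1.2 r.1.1
  have hz := TendstoZeroInProb.comp_continuousAt (P := P) (ι := VechIndex K)
    (Z := fun n ω => vech (U n ω) - vech (V n ω)) (z := 0) hr hcont
  simpa only [WithLp.toLp_zero, norm_zero, sub_zero, WithLp.toLp_sub] using hz

/-- Telescoping, LVL − ANA = (L − A)VL + A(V − N)L + AN(L − A); each other term contains the
vanishing factor D or is R. -/
theorem matTendstoZeroInProb_expansion {L V N D C R : ∀ n, Ω n → Matrix (Fin K) (Fin K) ℝ}
    (hLA : MatTendstoZeroInProb P fun n ω => L n ω - A)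
    (hVN : MatTendstoZeroInProb P fun n ω => V n ω - N n ω) (hN : MatBoundedInProb P N)
    (hD : MatTendstoZeroInProb P D) (hC : MatBoundedInProb P C) (hR : MatTendstoZeroInProb P R) :
    MatTendstoZeroInProb P fun n ω =>
      L n ω * V n ω * L n ω + D n ω * C n ω * L n ω + L n ω * C n ω * (D n ω)ᵀ
        + (√(n : ℝ))⁻¹ • (D n ω * C n ω * (D n ω)ᵀ) + R n ω - A * N n ω * A := by
  have hA : MatBoundedInProb P fun (n : ℕ) (_ : Ω n) => A := matBoundedInProb_const A
  have hL : MatBoundedInProb P L := by simpa using hLA.bounded.add hA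
  have hV : MatBoundedInProb P V := by simpa using hVN.bounded.add hN
  have h1 := (hLA.mul_bounded hV).mul_bounded hL
  have h2 := (hA.mul_tendstoZero hVN).mul_bounded hL
  have h3 := (hA.mul hN).mul_tendstoZero hLA
  have h4 := (hD.mul_bounded hC).mul_bounded hL
  have h5 := (hL.mul hC).mul_tendstoZero hD.transpose
  have h6 := ((hD.mul_bounded hC).mul_bounded hD.transpose.bounded).bounded.smul_tendstoZero
    (tendstoZeroInProb_of_tendsto (P := P) tendsto_inv_sqrt_natCast)
  refine ((((((h1.add h2).add h3).add h4).add h5).add h6).add hR).congr (s := fun _ => ∅)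
    (by simp) (.of_forall fun n ω _ => ?_)
  simp only [Matrix.sub_mul, Matrix.mul_sub, Matrix.mul_assoc]
  abel

/-! ### The error terms under the assumptions of the factor model -/

section Model

variable (hf : Measurable f) (hc : ∀ k, MemLp (fun ω => f ω k) 4 P₀)
  (hd : ∀ n a, MemLp (fun ω => ε n ω a) 4 P₀)
  (hmean : ∀ n a, P₀[fun ω => ε n ω a | MeasurableSpace.comap f inferInstance] =ᵐ[P₀] 0)
  (hcov : ∀ n a b, condCov (fun ω => ε n ω a) (fun ω => ε n ω b) f P₀ =ᵐ[P₀] fun _ => T n a b)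
  {d : ℝ} (hdb : ∀ n a, ∫ ω, ε n ω a ^ 4 ∂P₀ ≤ d)

include hf hd hmean hcov hdb in
theorem errorVariance_le (n : ℕ) (a : Fin (p n)) : T n a a ≤ 1 + d := by
  rw [← integral_errors hf (hmean n) (hcov n) a a]
  have h2 := memLp_two_mul (hd n a) (hd n a)
  refine (integral_mono (h2.integrable one_le_two) (h2.integrable one_le_two).abs
    fun ω => le_abs_self _).trans ((integral_abs_le_one_add_sq h2).trans ?_)
  have := hdb n a
  have e : ∀ ω, (ε n ω a * ε n ω a) ^ 2 = ε n ω a ^ 4 := fun ω => by ring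
  simp only [e]
  linarith

variable (hind : ∀ n, iIndepFun (fun i ω => (fs n i ω, es n i ω)) (P n))
  (hid : ∀ n i, IdentDistrib (fun ω => (fs n i ω, es n i ω)) (fun ω => (f ω, ε n ω)) (P n) P₀)
  (hBA : Tendsto (fun n => (p n : ℝ)⁻¹ • ((B n)ᵀ * B n)) atTop (𝓝 A))
  (hp : Tendsto p atTop atTop) (hT : ∀ n, (T n).IsDiag)

include hf hc hd hmean hcov hdb hind hid hBA hp hT in
-- Entry (k, l) is a normalized sum of p⁻¹(B_k'ε) f_l. Its second moment is at most p⁻² ∑ B_ak² T_aa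
-- E f_l² = O(1/p).
theorem matTendstoZeroInProb_loading_cross :
    MatTendstoZeroInProb P fun n ω => ((p n : ℝ)⁻¹ * (√(n : ℝ))⁻¹) •
      ((B n)ᵀ * (dataMat fun i => es n i ω) * (dataMat fun i => fs n i ω)ᵀ) := by
  intro k l
  set F := ∫ ω, f ω l ^ 2 ∂P₀ with hF
  have hF0 : 0 ≤ F := integral_nonneg fun _ => sq_nonneg _
  have hb : Tendsto (fun n => (p n : ℝ)⁻¹ * (((p n : ℝ)⁻¹ * ∑ a, B n a k ^ 2) * ((1 + d) * F)))
      atTop (𝓝 0) := by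
    simpa using (tendsto_inv_dim hp).mul ((tendsto_inv_mul_sum_sq hBA k).mul_const ((1 + d) * F))
  have h := tendstoZeroInProb_normSum (𝓧 := fun n => (Fin K → ℝ) × (Fin (p n) → ℝ))
    (φ := fun n x => (∑ a, (p n : ℝ)⁻¹ * B n a k * x.2 a) * x.1 l) hind hid
    (fun n => by fun_prop)
    (fun n => memLp_two_linComb_mul hc (hd n) (fun a => (p n : ℝ)⁻¹ * B n a k) l)
    (fun n => integral_linComb_mul hf hc (hd n) (hmean n) (fun a => (p n : ℝ)⁻¹ * B n a k) l)
    (fun n => by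
      rw [integral_linComb_mul_sq hf hc (hd n) (hmean n) (hcov n) (hT n)
        (fun a => (p n : ℝ)⁻¹ * B n a k) l]
      calc (∑ a, ((p n : ℝ)⁻¹ * B n a k) ^ 2 * T n a a) * F
          ≤ (∑ a, ((p n : ℝ)⁻¹ * B n a k) ^ 2 * (1 + d)) * F := by
            gcongr with a
            exact errorVariance_le hf hd hmean hcov hdb n a
        _ = _ := by
            rw [← Finset.sum_mul]
            simp only [mul_pow, ← Finset.mul_sum]
            ring) hb
  refine h.mono (.of_forall fun n ω => le_of_eq (congrArg _ ?_))
  simp only [normSum, Matrix.smul_apply, Matrix.mul_apply, Matrix.transpose_apply, dataMat,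
    Matrix.of_apply, smul_eq_mul]
  rw [mul_comm (p n : ℝ)⁻¹, mul_assoc]
  congr 1
  rw [Finset.mul_sum]
  refine Finset.sum_congr rfl fun i _ => ?_
  rw [← mul_assoc, Finset.mul_sum]
  simp only [mul_assoc]

include hf hd hmean hcov hdb hind hid hBA hp in
-- Each coordinate contributes a normalized sum of centered squared errors with second moment at
-- most E ε⁴ − T_aa² ≤ d, so the loading average applies.
theorem tendstoZeroInProb_errorVariance (k l : Fin K) :
    TendstoZeroInProb P fun n ω => ((p n : ℝ) ^ 2)⁻¹ * ∑ a, B n a k * B n a l *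
      ((√(n : ℝ))⁻¹ * ∑ i, (es n i ω a ^ 2 - T n a a)) := by
  have hsq : ∀ n a, MemLp (fun ω => ε n ω a ^ 2) 2 P₀ := fun n a => by
    simpa only [sq] using memLp_two_mul (hd n a) (hd n a)
  have hm : ∀ n a, ∫ ω, ε n ω a ^ 2 ∂P₀ = T n a a := fun n a => by
    simpa only [sq] using integral_errors hf (hmean n) (hcov n) a a
  have hφm : ∀ n (a : Fin (p n)), Measurable
      fun x : (Fin K → ℝ) × (Fin (p n) → ℝ) => x.2 a ^ 2 - T n a a := fun n a => by fun_prop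
  have hφ2 : ∀ n a, MemLp (fun ω => ε n ω a ^ 2 - T n a a) 2 P₀ :=
    fun n a => (hsq n a).sub (memLp_const _)
  have hφ0 : ∀ n a, ∫ ω, (ε n ω a ^ 2 - T n a a) ∂P₀ = 0 := fun n a => by
    rw [integral_sub ((hsq n a).integrable one_le_two) (integrable_const _), hm]
    simp
  have hφle : ∀ n a, ∫ ω, (ε n ω a ^ 2 - T n a a) ^ 2 ∂P₀ ≤ d := fun n a => by
    have hi4 : Integrable (fun ω => ε n ω a ^ 4) P₀ := by
      have := (hsq n a).integrable_sq
      simpa only [← pow_mul] using this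
    have hi2 : Integrable (fun ω => 2 * T n a a * ε n ω a ^ 2) P₀ :=
      ((hsq n a).integrable one_le_two).const_mul _
    have e : ∀ ω, (ε n ω a ^ 2 - T n a a) ^ 2 =
        ε n ω a ^ 4 - 2 * T n a a * ε n ω a ^ 2 + T n a a ^ 2 := fun ω => by ring
    simp only [e]
    have hi3 : Integrable (fun ω => ε n ω a ^ 4 - 2 * T n a a * ε n ω a ^ 2) P₀ := hi4.sub hi2
    rw [integral_add hi3 (integrable_const _), integral_sub hi4 hi2,
      integral_const_mul, hm]
    simp only [integral_const, probReal_univ, one_smul]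
    nlinarith [hdb n a, sq_nonneg (T n a a)]
  refine tendstoZeroInProb_loading_average (c := 1 + d)
    (r := fun n a => normSum (fun x => x.2 a ^ 2 - T n a a) fun i ω => (fs n i ω, es n i ω))
    (fun n a => (memLp_normSum (hid n) (hφm n a) (hφ2 n a)).integrable one_le_two)
    (fun n a => ?_) hBA hp k l
  refine (integral_abs_le_one_add_sq (memLp_normSum (hid n) (hφm n a) (hφ2 n a))).trans ?_
  have := integral_normSum_sq_le (hind n) (hid n) (hφm n a) (hφ2 n a) (hφ0 n a)
  linarith [hφle n a]

include hf hc hd hmean hcov hdb hind hid hBA hp in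
-- A product of two normalized sums is bounded in L¹ by their second moments, uniformly over
-- coordinates.
theorem tendstoZeroInProb_cross_quadratic (k l m m' : Fin K) :
    TendstoZeroInProb P fun n ω => ((p n : ℝ) ^ 2)⁻¹ * ∑ a, B n a k * B n a l *
      (((√(n : ℝ))⁻¹ * ∑ i, es n i ω a * fs n i ω m) *
        ((√(n : ℝ))⁻¹ * ∑ i, es n i ω a * fs n i ω m')) := by
  have hφm : ∀ n (a : Fin (p n)) (j : Fin K), Measurable
      fun x : (Fin K → ℝ) × (Fin (p n) → ℝ) => x.2 a * x.1 j := fun n a j => by fun_prop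
  have hφ2 : ∀ n a j, MemLp (fun ω => ε n ω a * f ω j) 2 P₀ :=
    fun n a j => memLp_two_mul (hd n a) (hc j)
  have hq : ∀ n a j, ∫ ω, normSum (fun x => x.2 a * x.1 j)
      (fun i ω => (fs n i ω, es n i ω)) ω ^ 2 ∂P n ≤ (1 + d) * ∫ ω, f ω j ^ 2 ∂P₀ :=
    fun n a j => by
      refine (integral_normSum_sq_le (hind n) (hid n) (hφm n a j) (hφ2 n a j)
        (integral_error_mul hf hc (hd n) (hmean n) a j)).trans ?_
      have e : ∀ ω, (ε n ω a * f ω j) ^ 2 = (ε n ω a * ε n ω a) * f ω j ^ 2 := fun ω => by ring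
      simp only [e]
      rw [integral_errors_mul_sq hf hc (hd n) (hmean n) (hcov n)]
      exact mul_le_mul_of_nonneg_right (errorVariance_le hf hd hmean hcov hdb n a)
        (integral_nonneg fun _ => sq_nonneg _)
  have hL : ∀ n a j, MemLp (normSum (fun x => x.2 a * x.1 j)
      (fun i ω => (fs n i ω, es n i ω))) 2 (P n) :=
    fun n a j => memLp_normSum (hid n) (hφm n a j) (hφ2 n a j)
  exact tendstoZeroInProb_loading_average
    (r := fun n a ω => normSum (fun x => x.2 a * x.1 m) (fun i ω => (fs n i ω, es n i ω)) ω *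
      normSum (fun x => x.2 a * x.1 m') (fun i ω => (fs n i ω, es n i ω)) ω)
    (fun n a => (hL n a m).integrable_mul (hL n a m'))
    (fun n a => (integral_abs_mul_le (hL n a m) (hL n a m')).trans
      (add_le_add (hq n a m) (hq n a m'))) hBA hp k l

include hf hc hd hmean hcov hdb hind hid hBA hp hT in
/-- The scaled estimation error is asymptotically equivalent to a congruence transform of the
normalized sum of the centered outer products of the factors. -/
theorem matTendstoZeroInProb_congr_SigmaHat_sub (hpd : (covMat f P₀).PosDef) :
    MatTendstoZeroInProb P fun n ω =>
      √(n : ℝ) • (((p n : ℝ) ^ 2)⁻¹ • ((B n)ᵀ *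
        (SigmaHat (dataMat fun i => fs n i ω)
            (B n * (dataMat fun i => fs n i ω) + dataMat fun i => es n i ω)
          - (B n * covMat f P₀ * (B n)ᵀ + T n)) * B n)) -
        A * normOuterSum f P₀ (fs n) ω * A := by
  have hindf : ∀ n, iIndepFun (fs n) (P n) := fun n =>
    (hind n).comp (fun _ => Prod.fst) fun _ => measurable_fst
  have hidf : ∀ n i, IdentDistrib (fs n i) f (P n) P₀ := fun n i => (hid n i).comp measurable_fst
  set X : ∀ n, Ω n → Matrix (Fin K) (Fin n) ℝ := fun n ω => dataMat fun i => fs n i ω with hX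
  set E : ∀ n, Ω n → Matrix (Fin (p n)) (Fin n) ℝ := fun n ω => dataMat fun i => es n i ω with hE
  set C := covMat f P₀ with hC
  set N : ∀ n, Ω n → Matrix (Fin K) (Fin K) ℝ := fun n ω => normOuterSum f P₀ (fs n) ω with hN
  set L : ∀ n, Ω n → Matrix (Fin K) (Fin K) ℝ := fun n _ => (p n : ℝ)⁻¹ • ((B n)ᵀ * B n) with hL
  set S : ∀ n, Ω n → Matrix (Fin K) (Fin K) ℝ :=
    fun n ω => (n : ℝ)⁻¹ • (X n ω * (X n ω)ᵀ) with hS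
  set W : ∀ n, Ω n → Matrix (Fin K) (Fin K) ℝ :=
    fun n ω => ((p n : ℝ)⁻¹ * (√(n : ℝ))⁻¹) • ((B n)ᵀ * E n ω * (X n ω)ᵀ) with hW
  set V : ∀ n, Ω n → Matrix (Fin K) (Fin K) ℝ :=
    fun n ω => √(n : ℝ) • (covHat (X n ω) - C) with hV
  set R : ∀ n, Ω n → Matrix (Fin K) (Fin K) ℝ := fun n ω => Matrix.of fun k l =>
    ((p n : ℝ) ^ 2)⁻¹ * ∑ a, B n a k * B n a l *
        ((√(n : ℝ))⁻¹ * ∑ i, (E n ω a i ^ 2 - T n a a))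
      - (√(n : ℝ))⁻¹ * ∑ m, ∑ m', (S n ω)⁻¹ m m' * (((p n : ℝ) ^ 2)⁻¹ * ∑ a, B n a k * B n a l *
          (((√(n : ℝ))⁻¹ * ∑ i, E n ω a i * X n ω m i) *
            ((√(n : ℝ))⁻¹ * ∑ i, E n ω a i * X n ω m' i))) with hR
  have hSM : MatTendstoZeroInProb P fun n ω =>
      S n ω - (Matrix.of fun k l => ∫ ω, f ω k * f ω l ∂P₀) :=
    matTendstoZeroInProb_secondMoment hindf hidf hc
  obtain ⟨hSinv, hSdet⟩ := MatTendstoZeroInProb.inv (S := S)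
    (det_secondMoment_ne_zero (fun k => memLp_two_of_four (hc k)) hpd) hSM
  have hLA0 : Tendsto (fun n => (p n : ℝ)⁻¹ • ((B n)ᵀ * B n) - A) atTop (𝓝 0) := by
    simpa using hBA.sub_const A
  have hLA : MatTendstoZeroInProb P fun n ω => L n ω - A :=
    matTendstoZeroInProb_of_tendsto (L := fun n => (p n : ℝ)⁻¹ • ((B n)ᵀ * B n) - A) hLA0
  have hNb : MatBoundedInProb P N := matBoundedInProb_normOuterSum hindf hidf hc
  have hVN : MatTendstoZeroInProb P fun n ω => V n ω - N n ω :=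
    matTendstoZeroInProb_covHat_sub hindf hidf hc
  have hVb : MatBoundedInProb P V := by
    simpa using hVN.bounded.add hNb
  have hcb : MatBoundedInProb P fun n ω => covHat (X n ω) := by
    -- Boundedness of √n(Ĉ − C) gives consistency of Ĉ; rescaling by n^(-1/2) needs n ≥ 1.
    have h1 := hVb.smul_tendstoZero (tendstoZeroInProb_of_tendsto (P := P) tendsto_inv_sqrt_natCast)
    have h0 : MatTendstoZeroInProb P fun n ω => covHat (X n ω) - C := by
      intro k l
      refine (h1 k l).mono ?_
      filter_upwards [eventually_ge_atTop 1] with n hn ω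
      have : √(n : ℝ) ≠ 0 := (Real.sqrt_pos.2 (by exact_mod_cast hn)).ne'
      simp only [hV]
      rw [smul_smul, inv_mul_cancel₀ this, one_smul]
    simpa using h0.bounded.add (matBoundedInProb_const C)
  have hW0 : MatTendstoZeroInProb P W :=
    matTendstoZeroInProb_loading_cross hf hc hd hmean hcov hdb hind hid hBA hp hT
  have hWS : MatTendstoZeroInProb P fun n ω => W n ω * (S n ω)⁻¹ := hW0.mul_bounded hSinv
  have hR0 : MatTendstoZeroInProb P R := fun k l =>
    (tendstoZeroInProb_errorVariance hf hd hmean hcov hdb hind hid hBA hp k l).sub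
      ((tendstoZeroInProb_of_tendsto tendsto_inv_sqrt_natCast).mul_bounded
        (TendstoZeroInProb.boundedInProb (TendstoZeroInProb.sum _ fun m _ =>
          TendstoZeroInProb.sum _ fun m' _ => (hSinv m m').mul_tendstoZero
            (tendstoZeroInProb_cross_quadratic hf hc hd hmean hcov hdb hind hid hBA hp k l m m'))))
  have hmain := matTendstoZeroInProb_expansion hLA hVN hNb hWS hcb hR0
  -- The algebraic identity requires XX' to be invertible; it is used off the event det S = 0, whose
  -- probability vanishes.
  refine hmain.congr (s := fun n => {ω | (S n ω).det = 0}) hSdet ?_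
  filter_upwards [eventually_ge_atTop 1] with n hn ω hω
  have hn0 : n ≠ 0 := by omega
  have hdet : (X n ω * (X n ω)ᵀ).det ≠ 0 := fun h0 => hω (by
    show ((n : ℝ)⁻¹ • (X n ω * (X n ω)ᵀ)).det = 0
    rw [Matrix.det_smul, h0, mul_zero])
  have hRe : R n ω = (√(n : ℝ) * ((p n : ℝ) ^ 2)⁻¹) •
      ((B n)ᵀ * (Sigma0Hat (X n ω) (B n * X n ω + E n ω) - T n) * B n) := by
    ext k l
    rw [smul_congr_diag_apply (S := S n ω) (E n ω) hdet hn0 (hT n) rfl]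
    rfl
  rw [smul_congr_SigmaHat_sub (L := L n ω) (S := S n ω) (W := W n ω) (V := V n ω) (E n ω) hdet hn0
    C (T n) rfl rfl rfl rfl, ← hRe]

end Model

end Errors

end FactorModel

/-! ### The asymptotic normality theorem -/

theorem theorem4
    -- number of factors, dimensions
    (K : ℕ) (p : ℕ → ℕ)
    -- population: the factors `f`, the same for all `n`, and the errors and loadings at stage `n`
    {Ω₀ : Type*} [MeasurableSpace Ω₀] (P₀ : Measure Ω₀) [IsProbabilityMeasure P₀]
    (f : Ω₀ → Fin K → ℝ) (hf : Measurable f)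
    (ε : ∀ n, Ω₀ → Fin (p n) → ℝ) (hε : ∀ n, Measurable (ε n))
    (B : ∀ n, Matrix (Fin (p n)) (Fin K) ℝ)
    (Sigma0 : ∀ n, Matrix (Fin (p n)) (Fin (p n)) ℝ)
    -- at stage `n`, a sample of size `n` on its own probability space
    {Ω : ℕ → Type*} [∀ n, MeasurableSpace (Ω n)] (P : ∀ n, Measure (Ω n))
    [∀ n, IsProbabilityMeasure (P n)]
    (fs : ∀ n, Fin n → Ω n → Fin K → ℝ) (hfs : ∀ n i, Measurable (fs n i))
    (ys : ∀ n, Fin n → Ω n → Fin (p n) → ℝ) (hys : ∀ n i, Measurable (ys n i))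
    -- (A): i.i.d. samples of `(f, y)`
    (hindep : ∀ n, iIndepFun (fun i ω => (fs n i ω, ys n i ω)) (P n))
    (hident : ∀ n i, IdentDistrib (fun ω => (fs n i ω, ys n i ω))
      (fun ω => (f ω, obs (B n) f (ε n) ω)) (P n) P₀)
    -- (A): conditional moments of the errors given the factors
    (hmean : ∀ n a, P₀[fun ω => ε n ω a | MeasurableSpace.comap f inferInstance] =ᵐ[P₀] 0)
    (hcov : ∀ n a b, condCov (fun ω => ε n ω a) (fun ω => ε n ω b) f P₀
      =ᵐ[P₀] fun _ => Sigma0 n a b)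
    (hdiag : ∀ n, (Sigma0 n).IsDiag)
    -- (A): continuous factor distribution and `K ≤ p`
    (hcont : ∀ x, (P₀.map f) {x} = 0) (hKp : ∀ n, K ≤ p n)
    -- (B): second moment of `y`, fourth moments of the factors and the errors
    (hb : (fun n => ∫ ω, ∑ a, (obs (B n) f (ε n) ω a) ^ 2 ∂P₀) =O[atTop] fun n => (p n : ℝ))
    (hc : ∀ k, MemLp (fun ω => f ω k) 4 P₀)
    (hd : ∀ n a, MemLp (fun ω => ε n ω a) 4 P₀)
    (hdb : ∃ d : ℝ, ∀ n a, ∫ ω, (ε n ω a) ^ 4 ∂P₀ ≤ d)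
    -- (B): eigenvalues of `cov(f)`
    (hlam : ∃ σ₁ : ℝ, 0 < σ₁ ∧ ∀ k, σ₁ ≤ (covMat_isHermitian f P₀).eigenvalues k)
    -- (D)
    (A : Matrix (Fin K) (Fin K) ℝ) (hA : A.PosSemidef)
    (hBA : Tendsto (fun n => (p n : ℝ)⁻¹ • ((B n)ᵀ * B n)) atTop (𝓝 A))
    -- diverging dimension
    (hp : Tendsto p atTop atTop) :
    (∀ i j k l : Fin K,
      cov[fun ω => outerProd f P₀ ω i j, fun ω => outerProd f P₀ ω k l; P₀] =
        cumulant4 f P₀ i j k l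
          + centralMom f P₀ ![i, k] * centralMom f P₀ ![j, l]
          + centralMom f P₀ ![i, l] * centralMom f P₀ ![j, k]) ∧
    (Gmat A (Hmat f P₀)).PosSemidef ∧
    TendstoInDistribution
      (fun (n : ℕ) (ω : Ω n) => WithLp.toLp 2 (√(n : ℝ) • vech (((p n : ℝ) ^ 2)⁻¹ •
        ((B n)ᵀ * (SigmaHat (dataMat fun i => fs n i ω) (dataMat fun i => ys n i ω)
          - covMat (obs (B n) f (ε n)) P₀) * B n))))
      atTop
      (id : EuclideanSpace ℝ (VechIndex K) → EuclideanSpace ℝ (VechIndex K))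
      P (multivariateGaussian 0 (Gmat A (Hmat f P₀))) := by
  have hAs : A.IsSymm := by
    have := hA.isHermitian.eq
    rwa [Matrix.conjTranspose_eq_transpose_of_trivial] at this
  refine ⟨fun i j k l => covariance_outerProd hc i j k l, posSemidef_Gmat hc hAs, ?_⟩
  obtain ⟨σ₁, hσ, hσle⟩ := hlam
  obtain ⟨d, hdb⟩ := hdb
  have hpd : (covMat f P₀).PosDef :=
    (covMat_isHermitian f P₀).posDef_iff_eigenvalues_pos.2 fun k => hσ.trans_le (hσle k)
  -- The sample errors are recovered as y − Bf. This is a measurable function of the observed pair,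
  -- so the pairs (f, e) remain i.i.d. with the law of (f, ε).
  set es : ∀ n, Fin n → Ω n → Fin (p n) → ℝ := fun n i ω => ys n i ω - B n *ᵥ fs n i ω with hes
  have hres : ∀ n, Measurable fun x : (Fin K → ℝ) × (Fin (p n) → ℝ) => (x.1, x.2 - B n *ᵥ x.1) := by
    intro n
    refine measurable_fst.prodMk (measurable_snd.sub ?_)
    exact (Continuous.matrix_mulVec continuous_const continuous_id).measurable.comp measurable_fst
  have hind : ∀ n, iIndepFun (fun i ω => (fs n i ω, es n i ω)) (P n) := fun n =>
    (hindep n).comp (fun _ x => (x.1, x.2 - B n *ᵥ x.1)) fun _ => hres n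
  have hid : ∀ n i, IdentDistrib (fun ω => (fs n i ω, es n i ω)) (fun ω => (f ω, ε n ω))
      (P n) P₀ := fun n i => by
    have h := (hident n i).comp (hres n)
    have e : (fun x : (Fin K → ℝ) × (Fin (p n) → ℝ) => (x.1, x.2 - B n *ᵥ x.1)) ∘
        (fun ω => (f ω, obs (B n) f (ε n) ω)) = fun ω => (f ω, ε n ω) := by
      funext ω
      simp [obs]
    rwa [e] at h
  have hindf : ∀ n, iIndepFun (fs n) (P n) := fun n =>
    (hind n).comp (fun _ => Prod.fst) fun _ => measurable_fst
  have hidf : ∀ n i, IdentDistrib (fs n i) f (P n) P₀ := fun n i => (hid n i).comp measurable_fst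
  have hY : ∀ n ω, (dataMat fun i => ys n i ω) =
      B n * (dataMat fun i => fs n i ω) + dataMat fun i => es n i ω := fun n ω => by
    ext a i
    simp [dataMat, hes, Matrix.mul_apply, Matrix.mulVec, dotProduct]
  have hdiff := matTendstoZeroInProb_congr_SigmaHat_sub hf hc hd hmean hcov hdb hind hid hBA hp
    hdiag hpd
  refine tendstoInDistribution_of_norm_sub
    (tendstoInDistribution_congr_normOuterSum hindf hidf hc hAs) (fun n => ?_) ?_
  · have hX : ∀ a i, Measurable fun ω => dataMat (fun i => fs n i ω) a i := fun a i =>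
      (measurable_pi_apply a).comp (hfs n i)
    have hYm : ∀ a i, Measurable fun ω => dataMat (fun i => ys n i ω) a i := fun a i =>
      (measurable_pi_apply a).comp (hys n i)
    have hS := measurable_mul_apply (M := fun _ : Ω n => (B n)ᵀ) (fun _ _ => measurable_const)
      (N := fun ω => SigmaHat (dataMat fun i => fs n i ω) (dataMat fun i => ys n i ω)
        - covMat (obs (B n) f (ε n)) P₀) fun a b =>
      (measurable_SigmaHat_apply hX hYm a b).sub_const _
    have hM := measurable_mul_apply hS (N := fun _ : Ω n => B n) fun _ _ => measurable_const
    have hv : Measurable fun ω => √(n : ℝ) • vech (((p n : ℝ) ^ 2)⁻¹ • ((B n)ᵀ *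
        (SigmaHat (dataMat fun i => fs n i ω) (dataMat fun i => ys n i ω)
          - covMat (obs (B n) f (ε n)) P₀) * B n)) :=
      measurable_pi_iff.2 fun r => ((hM r.1.2 r.1.1).const_mul _).const_mul _
    exact ((WithLp.measurable_toLp 2 _).comp hv).aemeasurable
  · have hz := tendstoZeroInProb_norm_vech_sub hdiff
    refine hz.mono (.of_forall fun n ω => le_of_eq (congrArg _ ?_))
    rw [hY n ω, covMat_obs hf hc (hd n) (hmean n) (hcov n)]
    rfl
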